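/- Let $\mathsf{EFA}=\mathrm{I}\Sigma_0+\exp$ be elementary function arithmetic: the classical first-order theory (with equality) in the language $\{0,1,+,\cdot,\exp,<\}$, $\exp(x,y)=x^y$, whose axioms are the usual axioms for successor and order ($x+1\neq 0$; $x+1=y+1\to x=y$; $\neg\,x<0$; $x<y+1\leftrightarrow x<y\vee x=y$), the recursion equations of $+$, $\cdot$ and $\exp$, and induction for all $\Sigma_0$ formulas of this language (formulas all of whose quantifiers are bounded), with parameters. For a finite set $H\subseteq\mathbb N$ let the gap size $gs(H)$ be the largest difference between two consecutive elements of $H$, and $gs(H)=1$ if $|H|\le 1$. For a function $f$ given by a term let $\mathsf{BL}_f$ be the statement: for all $r>0$ there exists $n$ such that every coloring $C\colon\{0,\dots,n-1\}\to\{0,\dots,r-1\}$ has a $C$-homogeneous set $H\subseteq\{0,\dots,n-1\}$ with $|H|>f(gs(H))$. In the language of arithmetic, finite sets are coded by binary expansions, finite functions by expansions in a suitable base, and $|H|=k$ means that there is a coded bijection from $\{0,\dots,k-1\}$ onto $H$. **Theorem.** The single sentence $(\forall m>0)\,\mathsf{BL}_{d\mapsto md}$ (finite Brown's lemma for all linear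 functions $f(d)=md$, with $m$ quantified inside the theory) is provable in $\mathsf{EFA}$: $$\mathsf{EFA}\vdash(\forall m>0)\,\mathsf{BL}_{d\mapsto md}.$$ -/

import Mathlib

namespace BrownEFA

open FirstOrder FirstOrder.Language

/-! ### Provability: classical natural deduction with equality -/

section Provability

variable {L : FirstOrder.Language.{0, 0}}

/-- `φ(t)`: the bound variable of `∀' φ` (the only bound variable that is loose in `φ`) is replaced
by the term `t`. Free variables are named by natural numbers, bound variables live in a separate
sort, so no capture can occur. -/
def instantiate (φ : L.BoundedFormula ℕ 1) (t : L.Term ℕ) : L.Formula ℕ :=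
  φ.toFormula.subst (Sum.elim Term.var fun _ => t)

/-- A sentence, viewed as a formula in the free variables `ℕ` (none of which occurs in it). -/
def ofSentence (σ : L.Sentence) : L.Formula ℕ :=
  Formula.relabel (Empty.elim : Empty → ℕ) σ

/-- `Derivable T Γ φ`: the formula `φ` has a natural deduction derivation from the axioms `T` with
open assumptions among `Γ`. The primitive connectives are `⊥`, `⟹`, `∀'` and equality. -/
inductive Derivable (T : L.Theory) : List (L.Formula ℕ) → L.Formula ℕ → Prop
  | axm {Γ : List (L.Formula ℕ)} {σ : L.Sentence} (h : σ ∈ T) : Derivable T Γ (ofSentence σ)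
  | hyp {Γ : List (L.Formula ℕ)} {φ : L.Formula ℕ} (h : φ ∈ Γ) : Derivable T Γ φ
  | impI {Γ : List (L.Formula ℕ)} {φ ψ : L.Formula ℕ} (h : Derivable T (φ :: Γ) ψ) :
      Derivable T Γ (φ ⟹ ψ)
  | impE {Γ : List (L.Formula ℕ)} {φ ψ : L.Formula ℕ} (h : Derivable T Γ (φ ⟹ ψ))
      (h' : Derivable T Γ φ) : Derivable T Γ ψ
  | raa {Γ : List (L.Formula ℕ)} {φ : L.Formula ℕ} (h : Derivable T (∼φ :: Γ) ⊥) :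
      Derivable T Γ φ
  | allI {Γ : List (L.Formula ℕ)} {φ : L.BoundedFormula ℕ 1} (x : ℕ)
      (hΓ : ∀ ψ ∈ Γ, x ∉ ψ.freeVarFinset) (hφ : x ∉ φ.freeVarFinset)
      (h : Derivable T Γ (instantiate φ (Term.var x))) : Derivable T Γ (∀' φ)
  | allE {Γ : List (L.Formula ℕ)} {φ : L.BoundedFormula ℕ 1} (t : L.Term ℕ)
      (h : Derivable T Γ (∀' φ)) : Derivable T Γ (instantiate φ t)
  | eqI {Γ : List (L.Formula ℕ)} (t : L.Term ℕ) : Derivable T Γ (Term.equal t t)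
  | eqE {Γ : List (L.Formula ℕ)} (φ : L.BoundedFormula ℕ 1) {s t : L.Term ℕ}
      (h : Derivable T Γ (Term.equal s t)) (h' : Derivable T Γ (instantiate φ s)) :
      Derivable T Γ (instantiate φ t)

/-- `T ⊢ σ`: the sentence `σ` is derivable from the theory `T`, without open assumptions. -/
def Provable (T : L.Theory) (σ : L.Sentence) : Prop :=
  Derivable T [] (ofSentence σ)

end Provability

/-! ### The language of arithmetic with exponentiation -/

/-- Function symbols `0, 1, +, ·, exp`, where `exp` is the binary function `x ^ y`. -/
inductive ArithFunc : ℕ → Type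
  | zero : ArithFunc 0
  | one : ArithFunc 0
  | add : ArithFunc 2
  | mul : ArithFunc 2
  | exp : ArithFunc 2

/-- The only relation symbol is `<`. -/
inductive ArithRel : ℕ → Type
  | lt : ArithRel 2

/-- The first-order language of arithmetic with exponentiation. -/
def LExp : FirstOrder.Language.{0, 0} := ⟨ArithFunc, ArithRel⟩

/-- Terms in `n` variables. -/
abbrev Tm (n : ℕ) : Type := LExp.Term (Empty ⊕ Fin n)

/-- Formulas in `n` variables. A quantifier in front of a formula in `n + 1` variables binds the
last one. -/
abbrev Fm (n : ℕ) : Type := LExp.BoundedFormula Empty n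

section Terms

variable {n : ℕ}

instance : Zero (Tm n) := ⟨Constants.term (L := LExp) ArithFunc.zero⟩
instance : One (Tm n) := ⟨Constants.term (L := LExp) ArithFunc.one⟩
instance : Add (Tm n) := ⟨Functions.apply₂ (L := LExp) ArithFunc.add⟩
instance : Mul (Tm n) := ⟨Functions.apply₂ (L := LExp) ArithFunc.mul⟩
instance : Pow (Tm n) (Tm n) := ⟨Functions.apply₂ (L := LExp) ArithFunc.exp⟩

/-- The atomic formula `s < t`. -/
def lt (s t : Tm n) : Fm n := Relations.boundedFormula₂ (L := LExp) ArithRel.lt s t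

/-- The `i`-th variable. -/
def var (i : Fin n) : Tm n := Term.var (Sum.inr i)

/-- The variable that has been quantified last. -/
def new : Tm (n + 1) := var (Fin.last n)

/-- A term in `n` variables, used under one more quantifier. -/
def up (t : Tm n) : Tm (n + 1) := t.relabel (Sum.map id Fin.castSucc)

/-- `(∀ x < t) φ(x)`. -/
def ball (t : Tm n) (φ : Fm (n + 1)) : Fm n := ∀' (lt new (up t) ⟹ φ)

/-- `(∃ x < t) φ(x)`. -/
def bex (t : Tm n) (φ : Fm (n + 1)) : Fm n := ∃' (lt new (up t) ⊓ φ)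

/-- Simultaneous substitution of the terms `ts i` for the variables of `φ`. -/
def substVars {m : ℕ} (φ : Fm m) (ts : Fin m → Tm n) : Fm n :=
  BoundedFormula.relabel (n := n) (k := 0) id
    (φ.toFormula.subst (Sum.elim Empty.elim ts))

end Terms

/-! ### Elementary function arithmetic -/

/-- `Σ₀` formulas: built from atomic formulas by propositional connectives (all of which are given
by `⊥` and `⟹`) and bounded quantifiers. -/
inductive IsSigma0 : ∀ {n : ℕ}, Fm n → Prop
  | falsum {n : ℕ} : IsSigma0 (⊥ : Fm n)
  | equal {n : ℕ} (s t : Tm n) : IsSigma0 (s =' t)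
  | lt {n : ℕ} (s t : Tm n) : IsSigma0 (lt s t)
  | imp {n : ℕ} {φ ψ : Fm n} (hφ : IsSigma0 φ) (hψ : IsSigma0 ψ) : IsSigma0 (φ ⟹ ψ)
  | ball {n : ℕ} (t : Tm n) {φ : Fm (n + 1)} (hφ : IsSigma0 φ) : IsSigma0 (ball t φ)
  | bex {n : ℕ} (t : Tm n) {φ : Fm (n + 1)} (hφ : IsSigma0 φ) : IsSigma0 (bex t φ)

/-- The universal closure of `φ(0) → ∀ x (φ(x) → φ(x + 1)) → ∀ x φ(x)`, where `x` is the last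
variable of `φ` and the other ones are parameters. -/
def inductionAxiom {n : ℕ} (φ : Fm (n + 1)) : LExp.Sentence :=
  BoundedFormula.alls
    (substVars φ (Fin.snoc var 0) ⟹
      (∀' (φ ⟹ substVars φ (Fin.snoc (fun i : Fin n => var i.castSucc) (new + 1)))) ⟹ ∀' φ)

/-- The basic axioms: successor, order, and the recursion equations of `+`, `·` and `exp`. -/
def basicAxioms : LExp.Theory :=
  let x : Tm 2 := var 0
  let y : Tm 2 := var 1
  { BoundedFormula.alls (∼((x + 1) =' 0)),
    BoundedFormula.alls ((x + 1) =' (y + 1) ⟹ x =' y),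
    BoundedFormula.alls ((x + 0) =' x),
    BoundedFormula.alls ((x + (y + 1)) =' ((x + y) + 1)),
    BoundedFormula.alls ((x * 0) =' 0),
    BoundedFormula.alls ((x * (y + 1)) =' (x * y + x)),
    BoundedFormula.alls ((x ^ (0 : Tm 2)) =' 1),
    BoundedFormula.alls ((x ^ (y + 1)) =' (x ^ y * x)),
    BoundedFormula.alls (∼(lt x 0)),
    BoundedFormula.alls (lt x (y + 1) ⇔ (lt x y ⊔ x =' y)) }

/-- Elementary function arithmetic `EFA = IΣ₀ + exp`. -/
def EFA : LExp.Theory :=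
  basicAxioms ∪ {σ | ∃ (n : ℕ) (φ : Fm (n + 1)), IsSigma0 φ ∧ σ = inductionAxiom φ}

/-! ### Finite combinatorics inside arithmetic

Finite functions and finite sets are coded by numbers: the number `c` codes, in base `b`, the
function sending `x` to the digit of `c` at `b ^ x`, and the number `h` codes the set of those `x`
for which `2 ^ x` occurs in the binary expansion of `h`. -/

section Coding

variable {n : ℕ}

/-- The digit of `c` at `b ^ x` in base `b` is `i`: `i < b` and
`c = u * b ^ (x + 1) + i * b ^ x + v` for some `u` and some `v < b ^ x`. -/
def digit (b c x i : Tm n) : Fm n :=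
  lt i b ⊓
    ∃' ∃' (
      let u : Tm (n + 2) := up new
      let v : Tm (n + 2) := new
      let b : Tm (n + 2) := up (up b)
      let c : Tm (n + 2) := up (up c)
      let x : Tm (n + 2) := up (up x)
      let i : Tm (n + 2) := up (up i)
      (c =' (u * b ^ (x + 1) + i * b ^ x + v)) ⊓ lt v (b ^ x))

/-- `x ∈ h`. -/
def mem (x h : Tm n) : Fm n := digit (1 + 1) h x 1

/-- `|h| = k`: there is a (code `s`, in base `h + 1`, of a) bijection from `{0, …, k - 1}` onto the
set `h`; note that all elements of `h` are smaller than the number `h`. -/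
def hasCard (h k : Tm n) : Fm n :=
  ∃' (
    let s : Tm (n + 1) := new
    let h : Tm (n + 1) := up h
    let k : Tm (n + 1) := up k
    -- every `j < k` is mapped into `h`
    ball k (∃' (mem new (up (up h)) ⊓ digit (up (up h) + 1) (up (up s)) (up new) new)) ⊓
    -- every `x ∈ h` is attained
    (∀' (mem new (up h) ⟹
      bex (up k) (digit (up (up h) + 1) (up (up s)) new (up new)))) ⊓
    -- distinct arguments `i, j < k` have no common value `x`
    ball k (ball (up k) (∀' (
      let i : Tm (n + 4) := up (up new)
      let j : Tm (n + 4) := up new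
      let x : Tm (n + 4) := new
      let s : Tm (n + 4) := up (up (up s))
      let h : Tm (n + 4) := up (up (up h))
      digit (h + 1) s i x ⟹ digit (h + 1) s j x ⟹ i =' j))))

/-- `x < y` are consecutive elements of `h`. -/
def consecutive (h x y : Tm n) : Fm n :=
  mem x h ⊓ mem y h ⊓ lt x y ⊓
    ∀' (mem new (up h) ⟹ ∼(lt (up x) new ⊓ lt new (up y)))

/-- `gs(h) = d`: either `d` is the largest difference of two consecutive elements of `h`, or `h` has
at most one element and `d = 1`. -/
def gapSize (h d : Tm n) : Fm n :=
  ((∃' ∃' (consecutive (up (up h)) (up new) new ⊓ new =' (up new + up (up d)))) ⊓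
    (∀' ∀' (consecutive (up (up h)) (up new) new ⟹ lt new (up new + up (up d) + 1)))) ⊔
  ((∀' ∀' (mem (up new) (up (up h)) ⟹ mem new (up (up h)) ⟹ up new =' new)) ⊓ d =' 1)

/-- `h` is a subset of `{0, …, N - 1}` that is homogeneous for the coloring `{0, …, N - 1} → r`
coded by `c` in base `r`. -/
def homogeneous (r N c h : Tm n) : Fm n :=
  ∃' ∀' (
    let i : Tm (n + 2) := up new
    let x : Tm (n + 2) := new
    mem x (up (up h)) ⟹ lt x (up (up N)) ⊓ digit (up (up r)) (up (up c)) x i)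

/-- `|h| > f(gs(h))`, where the function `f` is given by a term whose last variable is the argument
and whose other variables are parameters; these are the first `p` of the `p + q` variables in
scope. -/
def large {p q : ℕ} (f : Tm (p + 1)) (h : Tm (p + q)) : Fm (p + q) :=
  ∃' ∃' (
    let k : Tm (p + q + 2) := up new
    let d : Tm (p + q + 2) := new
    let fd : Tm (p + q + 2) := Term.subst f
      (Sum.elim Empty.elim
        (Fin.snoc (fun i : Fin p => var (((i.castAdd q).castSucc).castSucc)) d))
    hasCard (up (up h)) k ⊓ gapSize (up (up h)) d ⊓ lt fd k)

/-- The formula `BL_f`, with the parameters of the term `f` as free variables: for all `r > 0` there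
is `N` such that every coloring `C : {0, …, N - 1} → r` has a homogeneous set `H` with
`|H| > f(gs(H))`. The colorings are exactly the functions coded in base `r` by the numbers
`c < r ^ N`. -/
def BL {p : ℕ} (f : Tm (p + 1)) : Fm p :=
  ∀' (lt 0 new ⟹
    ∃' (ball (up new ^ (new : Tm (p + 2)))
      (∃' (
        let r : Tm (p + 4) := up (up (up new))
        let N : Tm (p + 4) := up (up new)
        let c : Tm (p + 4) := up new
        let h : Tm (p + 4) := new
        homogeneous r N c h ⊓ large (p := p) (q := 4) f h))))

/-- The sentence `(∀ m > 0) BL_{d ↦ m · d}`. -/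
def linearBL : LExp.Sentence :=
  ∀' (lt 0 new ⟹ BL (var 0 * var 1))

end Coding

end BrownEFA

/-! By Gödel's completeness theorem it suffices to verify the sentence in every model `M` of EFA.
The argument then takes place in the possibly nonstandard structure `M`, with no induction except
for `Σ₀` predicates with parameters (`EFAModel.induction`).

The combinatorial core is `brown_linear`. Put `F j = (3m)^(3^j)` and `N = F r`, and suppose that a
coloring has no large homogeneous set. By induction on `k`, with `j + k = r`, there is an interval
of length `F j` in `[0, N)` that avoids the colors below `k`. For the step, take `K = 2m F(j) + 1`
consecutive blocks of length `F j` inside an interval of length `F (j + 1)`; they fit because `F (j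
+ 1) = F j ^ 3`. If color `k` met every block, the least points of color `k` in the blocks would
form a homogeneous set of `K` elements with gaps at most `2 F(j)`, hence a large one
(`exists_large`). So some block also avoids `k`. At `k = r` a nonempty interval has no color left.

This works in EFA because `F` is given by a term: the bound is only doubly exponential in `r`, and
the invariant of the induction is `Σ₀` with parameters `m`, `r` and `c`. The sets and bijections
that the statement asks for come from bounded choice, `exists_code`, which builds codes digit by
digit.

Definability is handled semantically: `Sigma0` describes relations on `M` by closure rules, and
`exists_formula` turns them back into formulas when an induction axiom is invoked. -/

namespace BrownEFA

open FirstOrder FirstOrder.Language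

/-! ### Completeness of natural deduction over a countable language -/

section Completeness

variable {L : FirstOrder.Language.{0, 0}}

/-- The number of logical symbols of a formula. -/
def complexity {α : Type} : ∀ {n : ℕ}, L.BoundedFormula α n → ℕ
  | _, .falsum => 0
  | _, .equal _ _ => 0
  | _, .rel _ _ => 0
  | _, .imp φ ψ => complexity φ + complexity ψ + 1
  | _, .all φ => complexity φ + 1

theorem complexity_castLE {α : Type} {m n : ℕ} (h : m ≤ n) (φ : L.BoundedFormula α m) :
    complexity (φ.castLE h) = complexity φ := by
  induction φ generalizing n with
  | falsum => rfl
  | equal => rfl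
  | rel => rfl
  | imp _ _ ih₁ ih₂ => simp [BoundedFormula.castLE, complexity, ih₁, ih₂]
  | all _ ih => simp [BoundedFormula.castLE, complexity, ih]

theorem complexity_mapTermRel {α β : Type} {g : ℕ → ℕ}
    (ft : ∀ n, L.Term (α ⊕ (Fin n)) → L.Term (β ⊕ (Fin (g n))))
    (fr : ∀ n, L.Relations n → L.Relations n)
    (h : ∀ n, L.BoundedFormula β (g (n + 1)) → L.BoundedFormula β (g n + 1))
    (hh : ∀ n φ, complexity (h n φ) = complexity φ) {n : ℕ} (φ : L.BoundedFormula α n) :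
    complexity (φ.mapTermRel ft fr h) = complexity φ := by
  induction φ with
  | falsum => rfl
  | equal => rfl
  | rel => rfl
  | imp _ _ ih₁ ih₂ => simp [BoundedFormula.mapTermRel, complexity, ih₁, ih₂]
  | all _ ih => simp [BoundedFormula.mapTermRel, complexity, ih, hh]

theorem complexity_toFormula {α : Type} {n : ℕ} (φ : L.BoundedFormula α n) :
    complexity φ.toFormula = complexity φ := by
  induction φ with
  | falsum => rfl
  | equal => rfl
  | rel => rfl
  | imp _ _ ih₁ ih₂ => simp [BoundedFormula.toFormula, complexity, ih₁, ih₂]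
  | all _ ih =>
    simp only [BoundedFormula.toFormula, complexity]
    rw [← ih]
    congr 1
    exact complexity_mapTermRel _ _ _ (fun _ _ => complexity_castLE _ _) _

/-- An instance of `ψ` is not a structural subformula of `∀' ψ`. This invariance is what lets the
truth lemma `realize_iff` recurse on `complexity`. -/
theorem complexity_instantiate (φ : L.BoundedFormula ℕ 1) (t : L.Term ℕ) :
    complexity (instantiate φ t) = complexity φ := by
  rw [← complexity_toFormula φ]
  exact complexity_mapTermRel (g := fun n => n) _ _ (fun _ => id) (fun _ _ => rfl) _

theorem realize_instantiate {M : Type} [L.Structure M] (φ : L.BoundedFormula ℕ 1) (t : L.Term ℕ)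
    (v : ℕ → M) : (instantiate φ t).Realize v ↔ φ.Realize v (fun _ => t.realize v) := by
  unfold instantiate Formula.Realize
  rw [BoundedFormula.realize_subst]
  refine (BoundedFormula.realize_toFormula φ _).trans (iff_of_eq ?_)
  congr 1

theorem realize_ofSentence {M : Type} [L.Structure M] (σ : L.Sentence) (v : ℕ → M) :
    (ofSentence σ).Realize v ↔ M ⊨ σ := by
  unfold ofSentence
  rw [Formula.realize_relabel]
  exact iff_of_eq (congrArg (Formula.Realize σ) (Subsingleton.elim _ _))

/-- A term in free variables only, seen as a term with an additional loose bound variable. -/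
def weaken (t : L.Term ℕ) {n : ℕ} : L.Term (ℕ ⊕ Fin n) := t.relabel Sum.inl

/-- Substitution of `t` for the loose bound variable of a term. -/
def plug (a : L.Term (ℕ ⊕ Fin 1)) (t : L.Term ℕ) : L.Term ℕ :=
  a.subst (Sum.elim Term.var fun _ => t)

theorem subst_relabel {β γ : Type} (f : β → γ) (g : γ → L.Term ℕ) (t : L.Term β) :
    (t.relabel f).subst g = t.subst (g ∘ f) := by
  induction t with
  | var => rfl
  | func F ts ih => simp [Term.relabel, Term.subst, ih]

theorem subst_var (t : L.Term ℕ) : t.subst Term.var = t := by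
  induction t with
  | var => rfl
  | func F ts ih => simp [Term.subst, ih]

theorem plug_weaken (s t : L.Term ℕ) : plug (weaken s) t = s := by
  unfold plug weaken
  rw [subst_relabel]
  exact subst_var s

/-- `instantiate` passes through `toFormula`, which moves the loose variable to the free side. On
terms this detour amounts to plain substitution. -/
theorem lift_subst (a : L.Term (ℕ ⊕ Fin 1)) (g : ℕ ⊕ Fin 1 → L.Term ℕ) :
    (Term.relabel (Sum.inl : _ → (ℕ ⊕ Fin 1) ⊕ Fin 0) a).subst
      (Sum.elim (Term.relabel Sum.inl ∘ g) (Term.var ∘ Sum.inr)) =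
    ((a.subst g).relabel Sum.inl : L.Term (ℕ ⊕ Fin 0)) := by
  induction a with
  | var => rfl
  | func F ts ih => simp only [Term.relabel, Term.subst, ih]

theorem instantiate_equal (a b : L.Term (ℕ ⊕ Fin 1)) (t : L.Term ℕ) :
    instantiate (a =' b) t = Term.equal (plug a t) (plug b t) :=
  congrArg₂ BoundedFormula.equal (lift_subst a _) (lift_subst b _)

theorem instantiate_rel {l : ℕ} (R : L.Relations l) (ts : Fin l → L.Term (ℕ ⊕ Fin 1))
    (t : L.Term ℕ) :
    instantiate (BoundedFormula.rel R ts) t = R.formula fun i => plug (ts i) t :=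
  congrArg (BoundedFormula.rel R) (funext fun i => lift_subst (ts i) _)

/-! ### Consistent lists and Henkin sets. -/

variable {T : L.Theory}

/-- A finite list of formulas is consistent with `T`. -/
def Consistent (T : L.Theory) (Γ : List (L.Formula ℕ)) : Prop := ¬ Derivable T Γ ⊥

/-- One step of the Henkin construction. Since `Γ` is a finite list, some free variable is fresh and
can serve as the witness, so the language needs no new constants. If adding the negated instance
were inconsistent, `raa` and `allI` would derive the universal formula. -/
theorem Consistent.extend {Γ : List (L.Formula ℕ)} (hΓ : Consistent T Γ) (φ : L.Formula ℕ) :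
    ∃ Γ', Consistent T Γ' ∧ Γ ⊆ Γ' ∧ (φ ∈ Γ' ∨ (∼φ ∈ Γ' ∧
      ∀ ψ : L.BoundedFormula ℕ 1, φ = ∀' ψ → ∃ x, ∼(instantiate ψ (Term.var x)) ∈ Γ')) := by
  by_cases h : Consistent T (φ :: Γ)
  · exact ⟨_, h, List.subset_cons_self _ _, Or.inl List.mem_cons_self⟩
  have h₁ : Derivable T Γ (∼φ) := .impI (not_not.1 h)
  have h₂ : Consistent T (∼φ :: Γ) := fun h' => hΓ (.impE h₁ (.raa h'))
  by_cases hψ : ∃ ψ : L.BoundedFormula ℕ 1, φ = ∀' ψ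
  · obtain ⟨ψ, rfl⟩ := hψ
    obtain ⟨x, hx⟩ := Infinite.exists_notMem_finset
      (ψ.freeVarFinset ∪ ((∼(∀' ψ) :: Γ).map BoundedFormula.freeVarFinset).foldr (· ∪ ·) ∅)
    rw [Finset.mem_union, not_or] at hx
    have key : ∀ (l : List (L.Formula ℕ)),
        x ∉ (l.map BoundedFormula.freeVarFinset).foldr (· ∪ ·) ∅ →
        ∀ χ ∈ l, x ∉ BoundedFormula.freeVarFinset χ := by
      intro l
      induction l with
      | nil => simp
      | cons a l ih =>
        intro hl
        simp only [List.map_cons, List.foldr_cons, Finset.mem_union, not_or] at hl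
        simp only [List.mem_cons, forall_eq_or_imp]
        exact ⟨hl.1, ih hl.2⟩
    refine ⟨∼(instantiate ψ (Term.var x)) :: ∼(∀' ψ) :: Γ, fun h' => h₂ ?_, ?_, Or.inr ⟨?_, ?_⟩⟩
    · exact .impE (.hyp List.mem_cons_self) (.allI x (key _ hx.2) hx.1 (.raa h'))
    · exact fun a ha => List.mem_cons_of_mem _ (List.mem_cons_of_mem _ ha)
    · exact List.mem_cons_of_mem _ List.mem_cons_self
    · rintro ψ' h'
      cases h'
      exact ⟨x, List.mem_cons_self⟩
  · exact ⟨_, h₂, List.subset_cons_self _ _, Or.inr ⟨List.mem_cons_self,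
      fun ψ h' => (hψ ⟨ψ, h'⟩).elim⟩⟩

/-- Maximal consistent sets of formulas in which every false universal formula has a
counterexample that is a variable. -/
structure IsHenkin (T : L.Theory) (S : Set (L.Formula ℕ)) : Prop where
  consistent : ∀ Γ : List (L.Formula ℕ), (∀ φ ∈ Γ, φ ∈ S) →
    ∃ Γ', Consistent T Γ' ∧ Γ ⊆ Γ'
  complete : ∀ φ, φ ∈ S ∨ ∼φ ∈ S
  witness : ∀ ψ : L.BoundedFormula ℕ 1, (∀' ψ : L.Formula ℕ) ∉ S →
    ∃ x, ∼(instantiate ψ (Term.var x)) ∈ S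

/-- All formulas are enumerated, each is decided by `Consistent.extend` at its turn, and the union
of the resulting chain of lists is the Henkin set. -/
theorem Consistent.exists_isHenkin [Countable L.Symbols] {Γ : List (L.Formula ℕ)}
    (hΓ : Consistent T Γ) : ∃ S, IsHenkin T S ∧ ∀ φ ∈ Γ, φ ∈ S := by
  obtain ⟨e, he⟩ := exists_surjective_nat (L.Formula ℕ)
  choose! next h₁ h₂ h₃ using fun Γ (hΓ : Consistent T Γ) φ => hΓ.extend φ
  let c : ℕ → List (L.Formula ℕ) := fun k => Nat.rec Γ (fun k Δ => next Δ (e k)) k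
  have hc : ∀ k, Consistent T (c k) := fun k => by
    induction k with
    | zero => exact hΓ
    | succ k ih => exact h₁ _ ih _
  have hmono : ∀ i j, i ≤ j → c i ⊆ c j := fun i j hij => by
    induction hij with
    | refl => exact fun _ h => h
    | step _ ih => exact fun _ h => h₂ _ (hc _) _ (ih h)
  refine ⟨{φ | ∃ k, φ ∈ c k}, ⟨fun Δ hΔ => ?_, fun φ => ?_, fun ψ hψ => ?_⟩, fun φ h => ⟨0, h⟩⟩
  · suffices ∃ k, Δ ⊆ c k from this.imp' c fun k hk => ⟨hc k, hk⟩
    induction Δ with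
    | nil => exact ⟨0, by simp⟩
    | cons a Δ ih =>
      simp only [List.mem_cons, forall_eq_or_imp] at hΔ
      obtain ⟨⟨i, hi⟩, hΔ⟩ := hΔ
      obtain ⟨j, hj⟩ := ih hΔ
      exact ⟨max i j, List.cons_subset.2 ⟨hmono _ _ (le_max_left _ _) hi,
        fun _ h => hmono _ _ (le_max_right _ _) (hj h)⟩⟩
  · obtain ⟨k, rfl⟩ := he φ
    exact (h₃ _ (hc k) (e k)).imp (fun h => ⟨k + 1, h⟩) fun h => ⟨k + 1, h.1⟩
  · obtain ⟨k, hk⟩ := he (∀' ψ)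
    rcases h₃ _ (hc k) (e k) with h | h
    · exact (hψ ⟨k + 1, hk ▸ h⟩).elim
    · obtain ⟨x, hx⟩ := h.2 ψ hk
      exact ⟨x, k + 1, hx⟩

namespace IsHenkin

variable {S : Set (L.Formula ℕ)}

/-- Derivability is required from every list containing `Δ`, and `IsHenkin.consistent` yields only
some consistent superlist. This form avoids weakening, which would require renaming the
eigenvariables of `allI`. -/
theorem closed (hS : IsHenkin T S) (Δ : List (L.Formula ℕ)) (hΔ : ∀ φ ∈ Δ, φ ∈ S)
    {φ : L.Formula ℕ} (h : ∀ Γ, Δ ⊆ Γ → Derivable T Γ φ) : φ ∈ S := by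
  refine (hS.complete φ).resolve_right fun hn => ?_
  obtain ⟨Γ, hΓ, hsub⟩ := hS.consistent (∼φ :: Δ) (by simpa using ⟨hn, hΔ⟩)
  exact hΓ (.impE (.hyp (hsub List.mem_cons_self))
    (h Γ fun _ h => hsub (List.mem_cons_of_mem _ h)))

theorem not_mem_iff (hS : IsHenkin T S) (φ : L.Formula ℕ) : ∼φ ∈ S ↔ φ ∉ S := by
  refine ⟨fun h h' => ?_, fun h => (hS.complete φ).resolve_left h⟩
  obtain ⟨Γ, hΓ, hsub⟩ := hS.consistent [∼φ, φ] (by simpa using ⟨h, h'⟩)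
  exact hΓ (.impE (.hyp (hsub (by simp : ∼φ ∈ _))) (.hyp (hsub (by simp : φ ∈ _))))

theorem imp_mem_iff (hS : IsHenkin T S) (φ ψ : L.Formula ℕ) :
    (φ ⟹ ψ : L.Formula ℕ) ∈ S ↔ (φ ∈ S → ψ ∈ S) := by
  constructor
  · intro h h'
    exact hS.closed [φ ⟹ ψ, φ] (by simpa using ⟨h, h'⟩) fun Γ hΓ =>
      .impE (.hyp (hΓ (by simp : (φ ⟹ ψ) ∈ _))) (.hyp (hΓ (by simp)))
  · intro h
    by_cases h' : φ ∈ S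
    · exact hS.closed [ψ] (by simpa using h h') fun Γ hΓ =>
        .impI (.hyp (List.mem_cons_of_mem _ (hΓ (by simp))))
    · refine hS.closed [∼φ] (by simpa using (hS.not_mem_iff φ).2 h') fun Γ hΓ => .impI (.raa ?_)
      exact .impE (.hyp (List.mem_cons_of_mem _ (List.mem_cons_of_mem _ (hΓ (by simp : ∼φ ∈ _)))))
        (.hyp (List.mem_cons_of_mem _ List.mem_cons_self))

theorem all_mem_iff (hS : IsHenkin T S) (ψ : L.BoundedFormula ℕ 1) :
    (∀' ψ : L.Formula ℕ) ∈ S ↔ ∀ t, instantiate ψ t ∈ S := by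
  constructor
  · intro h t
    exact hS.closed [∀' ψ] (by simpa using h) fun Γ hΓ => .allE t (.hyp (hΓ (by simp)))
  · intro h
    by_contra h'
    obtain ⟨x, hx⟩ := hS.witness ψ h'
    exact (hS.not_mem_iff _).1 hx (h _)

theorem bot_notMem (hS : IsHenkin T S) : (⊥ : L.Formula ℕ) ∉ S := fun h => by
  obtain ⟨Γ, hΓ, hsub⟩ := hS.consistent [⊥] (by simpa using h)
  exact hΓ (.hyp (hsub (by simp)))

/-! ### Equality, the term model and the truth lemma. -/

theorem equal_refl (hS : IsHenkin T S) (t : L.Term ℕ) : Term.equal t t ∈ S :=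
  hS.closed [] (by simp) fun _ _ => .eqI t

theorem leibniz (hS : IsHenkin T S) (φ : L.BoundedFormula ℕ 1) {s t : L.Term ℕ}
    (h : Term.equal s t ∈ S) (h' : instantiate φ s ∈ S) : instantiate φ t ∈ S :=
  hS.closed [Term.equal s t, instantiate φ s] (by simpa using ⟨h, h'⟩) fun _ hΓ =>
    .eqE φ (.hyp (hΓ (by simp : Term.equal s t ∈ _))) (.hyp (hΓ (by simp)))

theorem equal_symm (hS : IsHenkin T S) {s t : L.Term ℕ} (h : Term.equal s t ∈ S) :
    Term.equal t s ∈ S := by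
  -- Replacement in the formula `x = s` turns `s = s` into `t = s`.
  have := hS.leibniz (Term.var (Sum.inr 0) =' weaken s) h
  simp only [instantiate_equal, plug_weaken] at this
  exact this (hS.equal_refl s)

theorem equal_trans (hS : IsHenkin T S) {s t u : L.Term ℕ} (h : Term.equal s t ∈ S)
    (h' : Term.equal t u ∈ S) : Term.equal s u ∈ S := by
  have := hS.leibniz (weaken s =' Term.var (Sum.inr 0)) h'
  simp only [instantiate_equal, plug_weaken] at this
  exact this h

theorem plug_update {l : ℕ} (ts : Fin l → L.Term ℕ) (i : Fin l) (s : L.Term ℕ) :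
    (fun j => plug (Function.update (fun k => weaken (ts k)) i (Term.var (Sum.inr 0)) j) s) =
      Function.update ts i s := by
  funext j
  by_cases h : j = i
  · subst h
    simp [plug, Term.subst]
  · simp [h, plug_weaken]

/-- The replacement of single arguments by equal ones yields that of all arguments. -/
theorem congr_of_update {l : ℕ} {Q : (Fin l → L.Term ℕ) → Prop}
    (hQ : ∀ ts i s, Term.equal (ts i) s ∈ S → Q ts → Q (Function.update ts i s))
    {ts us : Fin l → L.Term ℕ} (h : ∀ i, Term.equal (ts i) (us i) ∈ S) (h' : Q ts) : Q us := by
  classical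
  suffices ∀ A : Finset (Fin l), Q (fun i => if i ∈ A then us i else ts i) by
    simpa using this Finset.univ
  intro A
  induction A using Finset.induction_on with
  | empty => simpa using h'
  | insert a A ha ih =>
    convert hQ _ a (us a) (by simpa [ha] using h a) ih using 1
    funext i
    by_cases hi : i = a
    · subst hi; simp
    · simp [hi]

theorem equal_func (hS : IsHenkin T S) {l : ℕ} (f : L.Functions l) {ts us : Fin l → L.Term ℕ}
    (h : ∀ i, Term.equal (ts i) (us i) ∈ S) :
    Term.equal (Term.func f ts) (Term.func f us) ∈ S := by
  refine congr_of_update (Q := fun us => Term.equal (Term.func f ts) (Term.func f us) ∈ S)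
    (fun ws i s hi hw => ?_) h (hS.equal_refl _)
  have := hS.leibniz (weaken (Term.func f ts) =' Term.func f
    (Function.update (fun k => weaken (ws k)) i (Term.var (Sum.inr 0)))) hi
  have hp : ∀ s, plug (Term.func f (Function.update (fun k => weaken (ws k)) i
      (Term.var (Sum.inr 0)))) s = Term.func f (Function.update ws i s) :=
    fun s => congrArg (Term.func f) (plug_update ws i s)
  simp only [instantiate_equal, plug_weaken, hp, Function.update_eq_self] at this
  exact this hw

theorem rel_congr (hS : IsHenkin T S) {l : ℕ} (R : L.Relations l) {ts us : Fin l → L.Term ℕ}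
    (h : ∀ i, Term.equal (ts i) (us i) ∈ S) (h' : R.formula ts ∈ S) : R.formula us ∈ S := by
  refine congr_of_update (Q := fun us => R.formula us ∈ S) (fun ws i s hi hw => ?_) h h'
  have := hS.leibniz (BoundedFormula.rel R
    (Function.update (fun k => weaken (ws k)) i (Term.var (Sum.inr 0)))) hi
  simp only [instantiate_rel, plug_update, Function.update_eq_self] at this
  exact this hw

/-- Provable equality of terms. -/
def setoid (hS : IsHenkin T S) : Setoid (L.Term ℕ) where
  r s t := Term.equal s t ∈ S
  iseqv := ⟨hS.equal_refl, hS.equal_symm, hS.equal_trans⟩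

/-- The term model of a Henkin set. -/
def TermModel (hS : IsHenkin T S) : Type := Quotient hS.setoid

/-- The class of a term. -/
def cls (hS : IsHenkin T S) (t : L.Term ℕ) : hS.TermModel := Quotient.mk hS.setoid t

theorem cls_eq_iff (hS : IsHenkin T S) {s t : L.Term ℕ} :
    hS.cls s = hS.cls t ↔ Term.equal s t ∈ S :=
  ⟨fun h => Quotient.exact h, fun h => Quotient.sound (s := hS.setoid) h⟩

/-- A representative of an element of the term model. -/
noncomputable def rep (hS : IsHenkin T S) (a : hS.TermModel) : L.Term ℕ :=
  Quotient.out (s := hS.setoid) a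

theorem cls_rep (hS : IsHenkin T S) (a : hS.TermModel) : hS.cls (hS.rep a) = a :=
  Quotient.out_eq (s := hS.setoid) a

/-- Symbols are interpreted on chosen representatives, so the definition carries no well-definedness
obligation. Independence of the choice enters only in evaluation, through `equal_func` and
`rel_congr`. -/
noncomputable instance (hS : IsHenkin T S) : L.Structure hS.TermModel where
  funMap f xs := hS.cls (Term.func f fun i => hS.rep (xs i))
  RelMap R xs := R.formula (fun i => hS.rep (xs i)) ∈ S

theorem realize_term (hS : IsHenkin T S) (t : L.Term ℕ) :
    t.realize (fun n => hS.cls (Term.var n)) = hS.cls t := by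
  induction t with
  | var => rfl
  | func f ts ih =>
    simp only [Term.realize_func, ih]
    exact hS.cls_eq_iff.2 (hS.equal_func f fun i => hS.cls_eq_iff.1 (hS.cls_rep _))

theorem exists_relabel_inl (t : L.Term (ℕ ⊕ Fin 0)) : ∃ s : L.Term ℕ, t = s.relabel Sum.inl := by
  refine ⟨t.relabel (Sum.elim id fun i => i.elim0), ?_⟩
  rw [Term.relabel_relabel]
  conv_lhs => rw [← Term.relabel_id t]
  congr 1
  funext x
  rcases x with x | x
  · rfl
  · exact x.elim0

/-- The truth lemma: membership in `S` obeys the same clauses as satisfaction. In the quantifier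
case, every element of the model is the class of a term, so quantifying over elements is quantifying
over instances. -/
theorem realize_iff (hS : IsHenkin T S) (φ : L.Formula ℕ) :
    φ.Realize (fun n => hS.cls (Term.var n)) ↔ φ ∈ S := by
  induction h : complexity φ using Nat.strong_induction_on generalizing φ with
  | _ k ih =>
  subst h
  match φ with
  | .falsum => exact iff_of_false id hS.bot_notMem
  | .equal t₁ t₂ =>
    obtain ⟨s₁, rfl⟩ := exists_relabel_inl t₁
    obtain ⟨s₂, rfl⟩ := exists_relabel_inl t₂
    change (Term.equal s₁ s₂).Realize _ ↔ Term.equal s₁ s₂ ∈ S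
    rw [Formula.realize_equal, hS.realize_term, hS.realize_term, hS.cls_eq_iff]
  | .rel R ts =>
    choose ss hss using fun i => exists_relabel_inl (ts i)
    obtain rfl : ts = fun i => (ss i).relabel Sum.inl := funext hss
    change (R.formula ss).Realize _ ↔ R.formula ss ∈ S
    rw [Formula.realize_rel]
    simp only [hS.realize_term]
    exact ⟨hS.rel_congr R fun i => hS.cls_eq_iff.1 (hS.cls_rep _),
      hS.rel_congr R fun i => hS.cls_eq_iff.1 (hS.cls_rep _).symm⟩
  | .imp φ ψ =>
    refine Iff.trans ?_ (hS.imp_mem_iff φ ψ).symm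
    rw [← ih _ (by simp only [complexity]; omega) φ rfl,
      ← ih _ (by simp only [complexity]; omega) ψ rfl]
    rfl
  | .all ψ =>
    refine Iff.trans ?_ (hS.all_mem_iff ψ).symm
    have hi : ∀ t, instantiate ψ t ∈ S ↔
        ψ.Realize (fun n => hS.cls (Term.var n)) (fun _ => hS.cls t) := fun t => by
      rw [← ih _ (by simp only [complexity_instantiate, complexity]; omega) (instantiate ψ t) rfl,
        realize_instantiate, hS.realize_term]
    have hs : ∀ a : hS.TermModel, (Fin.snoc default a : Fin 1 → hS.TermModel) = fun _ => a :=
      fun a => funext fun i => by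
        rw [show i = Fin.last 0 from Subsingleton.elim (α := Fin 1) _ _, Fin.snoc_last]
    refine Iff.trans (BoundedFormula.realize_all (θ := ψ)) ?_
    simp only [hs, hi]
    exact ⟨fun h t => h _, fun h a => by simpa only [hS.cls_rep] using h (hS.rep a)⟩

end IsHenkin

/-- Gödel's completeness theorem. -/
theorem provable_of_models [Countable L.Symbols] {σ : L.Sentence}
    (h : ∀ (M : Type) [L.Structure M], M ⊨ T → M ⊨ σ) : Provable T σ := by
  by_contra hn
  have hc : Consistent T [∼(ofSentence σ)] := fun h' => hn (.raa h')
  obtain ⟨S, hS, hσ⟩ := hc.exists_isHenkin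
  have hσ' : ofSentence σ ∉ S := (hS.not_mem_iff _).1 (hσ _ (by simp))
  refine hσ' ((hS.realize_iff _).1 ((realize_ofSentence σ _).2 (h hS.TermModel ?_)))
  refine ⟨fun τ hτ => (realize_ofSentence τ fun n => hS.cls (Term.var n)).1
    ((hS.realize_iff _).2 ?_)⟩
  exact hS.closed [] (by simp) fun _ _ => .axm hτ

end Completeness

end BrownEFA

namespace BrownEFA

/-! ### Bounded definability in a structure with exponentiation -/

/-- The operations of the language of arithmetic with exponentiation. -/
class ExpOps (M : Type) extends Zero M, One M, Add M, Mul M, LT M where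
  /-- Exponentiation. -/
  pw : M → M → M

open ExpOps (pw)

section Definability

variable {M : Type} [ExpOps M] {n : ℕ} {A : Set M}

/-- Functions given by terms with parameters in `A`. -/
inductive TermFun (A : Set M) {n : ℕ} : ((Fin n → M) → M) → Prop
  | var (i : Fin n) : TermFun A fun v => v i
  | const {a : M} (h : a ∈ A) : TermFun A fun _ => a
  | zero : TermFun A fun _ => 0
  | one : TermFun A fun _ => 1
  | add {f g : (Fin n → M) → M} (hf : TermFun A f) (hg : TermFun A g) :
      TermFun A fun v => f v + g v
  | mul {f g : (Fin n → M) → M} (hf : TermFun A f) (hg : TermFun A g) :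
      TermFun A fun v => f v * g v
  | pw {f g : (Fin n → M) → M} (hf : TermFun A f) (hg : TermFun A g) :
      TermFun A fun v => pw (f v) (g v)

/-- Relations given by `Σ₀` formulas with parameters in `A`. -/
inductive Sigma0 (A : Set M) : ∀ {n : ℕ}, ((Fin n → M) → Prop) → Prop
  | falsum {n : ℕ} : Sigma0 A fun _ : Fin n → M => False
  | equal {n : ℕ} {f g : (Fin n → M) → M} (hf : TermFun A f) (hg : TermFun A g) :
      Sigma0 A fun v => f v = g v
  | lt {n : ℕ} {f g : (Fin n → M) → M} (hf : TermFun A f) (hg : TermFun A g) :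
      Sigma0 A fun v => f v < g v
  | imp {n : ℕ} {P Q : (Fin n → M) → Prop} (hP : Sigma0 A P) (hQ : Sigma0 A Q) :
      Sigma0 A fun v => P v → Q v
  | ball {n : ℕ} {f : (Fin n → M) → M} {Q : (Fin n → M) → M → Prop} (hf : TermFun A f)
      (hQ : Sigma0 A fun v : Fin (n + 1) → M => Q (fun i => v i.castSucc) (v (Fin.last n))) :
      Sigma0 A fun v => ∀ x, x < f v → Q v x
  | bex {n : ℕ} {f : (Fin n → M) → M} {Q : (Fin n → M) → M → Prop} (hf : TermFun A f)
      (hQ : Sigma0 A fun v : Fin (n + 1) → M => Q (fun i => v i.castSucc) (v (Fin.last n))) :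
      Sigma0 A fun v => ∃ x, x < f v ∧ Q v x

theorem TermFun.mono {B : Set M} (h : A ⊆ B) {f : (Fin n → M) → M} (hf : TermFun A f) :
    TermFun B f := by
  induction hf with
  | var i => exact .var i
  | const ha => exact .const (h ha)
  | zero => exact .zero
  | one => exact .one
  | add _ _ h₁ h₂ => exact .add h₁ h₂
  | mul _ _ h₁ h₂ => exact .mul h₁ h₂
  | pw _ _ h₁ h₂ => exact .pw h₁ h₂

theorem Sigma0.mono {B : Set M} (h : A ⊆ B) {P : (Fin n → M) → Prop} (hP : Sigma0 A P) :
    Sigma0 B P := by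
  induction hP with
  | falsum => exact .falsum
  | equal hf hg => exact .equal (hf.mono h) (hg.mono h)
  | lt hf hg => exact .lt (hf.mono h) (hg.mono h)
  | imp _ _ h₁ h₂ => exact .imp h₁ h₂
  | ball hf _ hQ => exact .ball (hf.mono h) hQ
  | bex hf _ hQ => exact .bex (hf.mono h) hQ

theorem TermFun.exists_finite {f : (Fin n → M) → M} (hf : TermFun A f) :
    ∃ B : Set M, B.Finite ∧ TermFun B f := by
  have two : ∀ {f g k : (Fin n → M) → M}, (∃ B : Set M, B.Finite ∧ TermFun B f) →
      (∃ B : Set M, B.Finite ∧ TermFun B g) →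
      (∀ B : Set M, TermFun B f → TermFun B g → TermFun B k) →
      ∃ B : Set M, B.Finite ∧ TermFun B k := by
    rintro f g k ⟨B, hB, hf⟩ ⟨C, hC, hg⟩ h
    exact ⟨B ∪ C, hB.union hC, h _ (hf.mono Set.subset_union_left)
      (hg.mono Set.subset_union_right)⟩
  induction hf with
  | var i => exact ⟨∅, Set.finite_empty, .var i⟩
  | const _ => exact ⟨{_}, Set.finite_singleton _, .const rfl⟩
  | zero => exact ⟨∅, Set.finite_empty, .zero⟩
  | one => exact ⟨∅, Set.finite_empty, .one⟩
  | add _ _ h₁ h₂ => exact two h₁ h₂ fun _ => .add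
  | mul _ _ h₁ h₂ => exact two h₁ h₂ fun _ => .mul
  | pw _ _ h₁ h₂ => exact two h₁ h₂ fun _ => .pw

/-- A definition mentions only finitely many parameters. They can therefore be the values of the
parameter variables of a single induction axiom. -/
theorem Sigma0.exists_finite {P : (Fin n → M) → Prop} (hP : Sigma0 A P) :
    ∃ B : Set M, B.Finite ∧ Sigma0 B P := by
  induction hP with
  | falsum => exact ⟨∅, Set.finite_empty, .falsum⟩
  | equal hf hg =>
    obtain ⟨B, hB, hf⟩ := hf.exists_finite
    obtain ⟨C, hC, hg⟩ := hg.exists_finite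
    exact ⟨B ∪ C, hB.union hC, .equal (hf.mono Set.subset_union_left)
      (hg.mono Set.subset_union_right)⟩
  | lt hf hg =>
    obtain ⟨B, hB, hf⟩ := hf.exists_finite
    obtain ⟨C, hC, hg⟩ := hg.exists_finite
    exact ⟨B ∪ C, hB.union hC, .lt (hf.mono Set.subset_union_left)
      (hg.mono Set.subset_union_right)⟩
  | imp _ _ h₁ h₂ =>
    obtain ⟨B, hB, h₁⟩ := h₁
    obtain ⟨C, hC, h₂⟩ := h₂
    exact ⟨B ∪ C, hB.union hC, .imp (h₁.mono Set.subset_union_left)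
      (h₂.mono Set.subset_union_right)⟩
  | ball hf _ hQ =>
    obtain ⟨B, hB, hf⟩ := hf.exists_finite
    obtain ⟨C, hC, hQ⟩ := hQ
    exact ⟨B ∪ C, hB.union hC, .ball (hf.mono Set.subset_union_left)
      (hQ.mono Set.subset_union_right)⟩
  | bex hf _ hQ =>
    obtain ⟨B, hB, hf⟩ := hf.exists_finite
    obtain ⟨C, hC, hQ⟩ := hQ
    exact ⟨B ∪ C, hB.union hC, .bex (hf.mono Set.subset_union_left)
      (hQ.mono Set.subset_union_right)⟩

namespace Sigma0

variable {P Q : (Fin n → M) → Prop}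

theorem not (hP : Sigma0 A P) : Sigma0 A fun v => ¬ P v := hP.imp .falsum

theorem or (hP : Sigma0 A P) (hQ : Sigma0 A Q) : Sigma0 A fun v => P v ∨ Q v := by
  simpa only [or_iff_not_imp_left] using hP.not.imp hQ

theorem and (hP : Sigma0 A P) (hQ : Sigma0 A Q) : Sigma0 A fun v => P v ∧ Q v := by
  simpa only [Classical.not_imp, not_not] using (hP.imp hQ.not).not

end Sigma0

/-- Relations given by `Σ₀` formulas with arbitrary parameters. -/
abbrev Bdd (P : (Fin n → M) → Prop) : Prop := Sigma0 Set.univ P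

/-- Functions given by terms with arbitrary parameters. -/
abbrev TF (f : (Fin n → M) → M) : Prop := TermFun Set.univ f

/-- Unary predicates given by `Σ₀` formulas with parameters, in any term as argument. -/
def Bdd₁ (P : M → Prop) : Prop := ∀ {n : ℕ} {f : (Fin n → M) → M}, TF f → Bdd fun v => P (f v)

/-- Binary predicates given by `Σ₀` formulas with parameters, in any terms as arguments. -/
def Bdd₂ (P : M → M → Prop) : Prop :=
  ∀ {n : ℕ} {f g : (Fin n → M) → M}, TF f → TF g → Bdd fun v => P (f v) (g v)

end Definability

/-- Models of elementary function arithmetic. -/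
class EFAModel (M : Type) extends ExpOps M where
  succ_ne_zero (x : M) : x + 1 ≠ 0
  succ_inj (x y : M) : x + 1 = y + 1 → x = y
  plus_zero (x : M) : x + 0 = x
  plus_succ (x y : M) : x + (y + 1) = x + y + 1
  times_zero (x : M) : x * 0 = 0
  times_succ (x y : M) : x * (y + 1) = x * y + x
  pw_zero (x : M) : pw x 0 = 1
  pw_succ (x y : M) : pw x (y + 1) = pw x y * x
  not_below_zero (x : M) : ¬ x < 0
  below_succ (x y : M) : x < y + 1 ↔ x < y ∨ x = y
  induction (P : M → Prop) (hP : Bdd fun v : Fin 1 → M => P (v 0)) (h₀ : P 0)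
    (h₁ : ∀ x, P x → P (x + 1)) (x : M) : P x

/-- A term function remains one if a variable is added. -/
theorem TermFun.lift {M : Type} [ExpOps M] {n : ℕ} {A : Set M} {f : (Fin n → M) → M}
    (hf : TermFun A f) : TermFun A fun v : Fin (n + 1) → M => f fun j => v j.castSucc := by
  induction hf with
  | var i => exact .var _
  | const h => exact .const h
  | zero => exact .zero
  | one => exact .one
  | add _ _ h₁ h₂ => exact .add h₁ h₂
  | mul _ _ h₁ h₂ => exact .mul h₁ h₂
  | pw _ _ h₁ h₂ => exact .pw h₁ h₂

/-- An explicit function is recognized as a term function by its shape. -/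
theorem TF.auto {M : Type} [ExpOps M] {n : ℕ} {f : (Fin n → M) → M}
    (h : TF f := by
      repeat' first
        | assumption
        | exact TermFun.const trivial
        | exact TermFun.var _
        | apply TermFun.add
        | apply TermFun.mul
        | apply TermFun.pw) : TF f := h

/-- An explicit relation is recognized as `Σ₀` by its shape. -/
theorem Bdd.auto {M : Type} [ExpOps M] {n : ℕ} {P : (Fin n → M) → Prop}
    (h : Bdd P := by
      repeat' first
        | assumption
        | exact TermFun.const trivial
        | exact TermFun.var _
        | exact Sigma0.falsum
        | apply TermFun.add
        | apply TermFun.mul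
        | apply TermFun.pw
        | apply Sigma0.not
        | apply Sigma0.equal
        | apply Sigma0.lt
        | apply Sigma0.or
        | apply Sigma0.bex
        | apply Sigma0.and
        | apply Sigma0.ball
        | apply Sigma0.imp) : Bdd P := h

/-! ### Models of elementary function arithmetic as ordered semirings -/

namespace EFAModel

variable {M : Type} [EFAModel M]

theorem zero_plus (x : M) : 0 + x = x :=
  induction (fun x : M => 0 + x = x) Bdd.auto (plus_zero 0) (fun x h => by rw [plus_succ, h]) x

theorem succ_plus (x y : M) : x + 1 + y = x + y + 1 :=
  induction (fun y => x + 1 + y = x + y + 1) Bdd.auto (by rw [plus_zero, plus_zero])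
    (fun y h => by rw [plus_succ, h, plus_succ]) y

theorem plus_comm (x y : M) : x + y = y + x :=
  induction (fun y => x + y = y + x) Bdd.auto (by rw [plus_zero, zero_plus])
    (fun y h => by rw [plus_succ, h, succ_plus]) y

theorem plus_assoc (x y z : M) : x + y + z = x + (y + z) :=
  induction (fun z => x + y + z = x + (y + z)) Bdd.auto (by rw [plus_zero, plus_zero])
    (fun z h => by rw [plus_succ, h, plus_succ, plus_succ]) z

theorem zero_times (x : M) : 0 * x = 0 :=
  induction (fun x : M => 0 * x = 0) Bdd.auto (times_zero 0)
    (fun x h => by rw [times_succ, h, plus_zero]) x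

theorem succ_times (x y : M) : (x + 1) * y = x * y + y :=
  induction (fun y => (x + 1) * y = x * y + y) Bdd.auto
    (by rw [times_zero, times_zero, plus_zero])
    (fun y h => by
      rw [times_succ, h, times_succ, ← plus_assoc, ← plus_assoc, plus_assoc (x * y), plus_comm y x,
        ← plus_assoc]) y

theorem times_comm (x y : M) : x * y = y * x :=
  induction (fun y => x * y = y * x) Bdd.auto (by rw [times_zero, zero_times])
    (fun y h => by rw [times_succ, h, succ_times]) y

theorem times_plus (x y z : M) : x * (y + z) = x * y + x * z :=
  induction (fun z => x * (y + z) = x * y + x * z) Bdd.auto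
    (by rw [plus_zero, times_zero, plus_zero])
    (fun z h => by rw [plus_succ, times_succ, h, times_succ, plus_assoc]) z

theorem times_assoc (x y z : M) : x * y * z = x * (y * z) :=
  induction (fun z => x * y * z = x * (y * z)) Bdd.auto (by rw [times_zero, times_zero, times_zero])
    (fun z h => by rw [times_succ, h, times_succ, times_plus]) z

instance : CommSemiring M where
  add_assoc := plus_assoc
  zero_add := zero_plus
  add_zero := plus_zero
  add_comm := plus_comm
  mul_assoc := times_assoc
  one_mul x := by rw [← zero_plus 1, succ_times, zero_times, zero_plus]
  mul_one x := by rw [← zero_plus 1, times_succ, times_zero, zero_plus]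
  mul_comm := times_comm
  left_distrib := times_plus
  right_distrib x y z := by rw [times_comm, times_plus, times_comm z, times_comm z]
  zero_mul := zero_times
  mul_zero := times_zero
  nsmul := nsmulRec

/-! ### The order and its compatibility with addition and multiplication. -/

theorem plus_right_cancel {x y z : M} : x + z = y + z → x = y :=
  induction (fun z => x + z = y + z → x = y) Bdd.auto (by simp)
    (fun z h h' => h (succ_inj _ _ (by rwa [← plus_succ, ← plus_succ]))) z

theorem succ_below_succ {x y : M} : x < y → x + 1 < y + 1 :=
  induction (fun y => x < y → x + 1 < y + 1) Bdd.auto (fun h => (not_below_zero _ h).elim)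
    (fun y ih h => by
      rcases (below_succ _ _).1 h with h | rfl
      · exact (below_succ _ _).2 (Or.inl (ih h))
      · exact (below_succ _ _).2 (Or.inr rfl)) y

theorem exists_of_below {x y : M} (hxy : x < y) : ∃ z, y = x + (z + 1) := by
  -- The redundant bound `z < y` makes the predicate `Σ₀`, so that induction applies.
  have : x < y → ∃ z, z < y ∧ y = x + (z + 1) :=
    induction (fun y => x < y → ∃ z, z < y ∧ y = x + (z + 1)) Bdd.auto
    (fun h => (not_below_zero _ h).elim)
    (fun y ih h => by
      rcases (below_succ _ _).1 h with h | rfl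
      · obtain ⟨z, hz, e⟩ := ih h
        exact ⟨z + 1, succ_below_succ hz, by rw [plus_succ x (z + 1), ← e]⟩
      · refine ⟨0, ?_, by rw [zero_plus]⟩
        refine induction (fun x => 0 < x + 1) Bdd.auto ?_ ?_ x
        · exact (below_succ _ _).2 (Or.inr rfl)
        · exact fun x h => (below_succ _ _).2 (Or.inl h)) y
  obtain ⟨z, -, h⟩ := this hxy
  exact ⟨z, h⟩

theorem below_plus_succ (x z : M) : x < x + (z + 1) :=
  induction (fun z => x < x + (z + 1)) Bdd.auto
    (by rw [zero_plus]; exact (below_succ _ _).2 (Or.inr rfl))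
    (fun z h => by rw [plus_succ]; exact (below_succ _ _).2 (Or.inl h)) z

theorem below_iff {x y : M} : x < y ↔ ∃ z, y = x + (z + 1) :=
  ⟨exists_of_below, by rintro ⟨z, rfl⟩; exact below_plus_succ x z⟩

theorem below_irrefl (x : M) : ¬ x < x := fun h => by
  obtain ⟨z, hz⟩ := below_iff.1 h
  refine succ_ne_zero z (plus_right_cancel (z := x) ?_)
  rw [zero_plus, plus_comm, ← hz]

theorem below_trans {x y z : M} (h : x < y) (h' : y < z) : x < z := by
  obtain ⟨a, rfl⟩ := below_iff.1 h
  obtain ⟨b, rfl⟩ := below_iff.1 h'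
  exact below_iff.2 ⟨a + 1 + b, by ring⟩

theorem eq_zero_or_pos' (x : M) : x = 0 ∨ 0 < x :=
  induction (fun x : M => x = 0 ∨ 0 < x) Bdd.auto (Or.inl rfl)
    (fun x h => Or.inr ((below_succ _ _).2 (h.symm.imp_right Eq.symm))) x

theorem below_trichotomy (x y : M) : x < y ∨ x = y ∨ y < x :=
  induction (fun x => x < y ∨ x = y ∨ y < x) Bdd.auto
    ((eq_zero_or_pos' y).elim (fun h => Or.inr (Or.inl h.symm)) Or.inl)
    (fun x h => by
      rcases h with h | h | h
      · obtain ⟨z, rfl⟩ := below_iff.1 h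
        rcases eq_zero_or_pos' z with rfl | hz
        · exact Or.inr (Or.inl (by rw [zero_plus]))
        · obtain ⟨w, rfl⟩ := below_iff.1 hz
          exact Or.inl (below_iff.2 ⟨w, by ring⟩)
      · exact Or.inr (Or.inr ((below_succ _ _).2 (Or.inr h.symm)))
      · exact Or.inr (Or.inr ((below_succ _ _).2 (Or.inl h)))) x

noncomputable instance : LinearOrder M where
  -- With this choice the axiom `below_succ` is literally `x < y + 1 ↔ x ≤ y`, and `≤` is visibly
  -- `Σ₀`.
  le x y := x < y ∨ x = y
  lt x y := x < y
  le_refl x := Or.inr rfl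
  le_trans x y z := by
    rintro (h | rfl) (h' | rfl)
    · exact Or.inl (below_trans h h')
    · exact Or.inl h
    · exact Or.inl h'
    · exact Or.inr rfl
  le_antisymm x y := by
    rintro (h | h) (h' | h')
    · exact (below_irrefl _ (below_trans h h')).elim
    · exact h'.symm
    · exact h
    · exact h
  le_total x y := by
    rcases below_trichotomy x y with h | h | h
    · exact Or.inl (Or.inl h)
    · exact Or.inl (Or.inr h)
    · exact Or.inr (Or.inl h)
  lt_iff_le_not_ge x y := by
    constructor
    · refine fun h => ⟨Or.inl h, ?_⟩
      rintro (h' | rfl)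
      · exact below_irrefl _ (below_trans h h')
      · exact below_irrefl _ h
    · rintro ⟨h | rfl, h'⟩
      · exact h
      · exact (h' (Or.inr rfl)).elim
  toDecidableLE := Classical.decRel _

theorem le_iff_exists_plus (x y : M) : x ≤ y ↔ ∃ z, y = x + z := by
  constructor
  · rintro (h | rfl)
    · exact (below_iff.1 h).imp' (· + 1) fun _ => id
    · exact ⟨0, by simp⟩
  · rintro ⟨z, rfl⟩
    rcases eq_zero_or_pos' z with rfl | hz
    · simp
    · obtain ⟨w, rfl⟩ := below_iff.1 hz
      exact Or.inl (below_iff.2 ⟨w, by ring⟩)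

instance : CanonicallyOrderedAdd M where
  exists_add_of_le h := (le_iff_exists_plus _ _).1 h
  le_self_add _ y := (le_iff_exists_plus _ _).2 ⟨y, rfl⟩
  le_add_self _ y := (le_iff_exists_plus _ _).2 ⟨y, add_comm _ _⟩

instance : IsOrderedCancelAddMonoid M where
  add_le_add_left x y h z := by
    obtain ⟨w, rfl⟩ := (le_iff_exists_plus _ _).1 h
    exact (le_iff_exists_plus _ _).2 ⟨w, by ring⟩
  le_of_add_le_add_left z x y h := by
    obtain ⟨w, hw⟩ := (le_iff_exists_plus _ _).1 h
    refine (le_iff_exists_plus _ _).2 ⟨w, plus_right_cancel (z := z) ?_⟩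
    rw [add_comm, hw]; ring

theorem mul_lt_mul_aux {a x y : M} (ha : 0 < a) (h : x < y) : a * x < a * y := by
  obtain ⟨b, rfl⟩ := below_iff.1 ha
  obtain ⟨c, rfl⟩ := below_iff.1 h
  exact below_iff.2 ⟨b * c + b + c, by ring⟩

instance : IsStrictOrderedRing M where
  zero_le_one := zero_le
  exists_pair_ne := ⟨1, 0, fun h => succ_ne_zero (0 : M) (by rw [zero_plus, h])⟩
  mul_lt_mul_of_pos_left a ha x y h := mul_lt_mul_aux ha h
  mul_lt_mul_of_pos_right a ha x y h := by
    simpa only [mul_comm _ a] using mul_lt_mul_aux ha h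

theorem lt_succ_iff' {x y : M} : x < y + 1 ↔ x ≤ y := below_succ x y

theorem succ_le_iff' {x y : M} : x + 1 ≤ y ↔ x < y := by
  rw [← lt_succ_iff', add_lt_add_iff_right]

theorem pos_iff_one_le {x : M} : 0 < x ↔ 1 ≤ x := by
  rw [← succ_le_iff', zero_add]

theorem exists_succ_of_pos {x : M} (h : 0 < x) : ∃ y, x = y + 1 :=
  (below_iff.1 h).imp fun y h => by rw [h, zero_add]

theorem pw_add (b x y : M) : pw b (x + y) = pw b x * pw b y :=
  induction (fun y => pw b (x + y) = pw b x * pw b y) Bdd.auto (by simp [pw_zero])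
    (fun y h => by rw [← add_assoc, pw_succ, h, pw_succ, mul_assoc]) y

/-! ### Positivity and growth of exponentiation. -/

theorem pw_pos {b : M} (hb : 0 < b) (x : M) : 0 < pw b x :=
  induction (fun x => 0 < pw b x) Bdd.auto (by simp [pw_zero])
    (fun x h => by rw [pw_succ]; exact mul_pos h hb) x

theorem pw_mono {b x y : M} (hb : 0 < b) (h : x ≤ y) : pw b x ≤ pw b y := by
  obtain ⟨z, rfl⟩ := (le_iff_exists_plus _ _).1 h
  rw [pw_add]
  exact le_mul_of_one_le_right (zero_le) (pos_iff_one_le.1 (pw_pos hb z))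

theorem lt_pw_two (x : M) : x < pw (1 + 1) x :=
  induction (fun x : M => x < pw (1 + 1) x) Bdd.auto (by simp [pw_zero])
    (fun x h => by
      have := succ_le_iff'.2 h
      have h0 : (0 : M) < 1 := one_pos
      have h1 : (0 : M) ≤ x := zero_le
      rw [pw_succ, mul_add, mul_one]
      grind) x

end EFAModel

end BrownEFA

namespace BrownEFA

open ExpOps (pw)

namespace EFAModel

variable {M : Type} [EFAModel M]

/-! ### Coding of finite functions and sets -/

/-- If there were no least element, `Σ₀` induction on `n` would show that `P` fails everywhere below
`n`. -/
theorem exists_least {P : M → Prop} (hP : Bdd₁ P) {x : M} (hx : P x) :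
    ∃ y, P y ∧ ∀ z, z < y → ¬ P z := by
  by_contra h
  push Not at h
  have key : ∀ n : M, ∀ y, y < n → ¬ P y := by
    refine induction (fun n => ∀ y, y < n → ¬ P y) (.ball (.var _) (.not (hP (.var _))))
      (fun y hy => (not_below_zero _ hy).elim) fun n ih y hy hPy => ?_
    rcases (below_succ _ _).1 hy with hy | rfl
    · exact ih y hy hPy
    · obtain ⟨z, hz, hPz⟩ := h y hPy
      exact ih z hz hPz
  exact key (x + 1) x (lt_add_one x) hx

theorem exists_div (c : M) {b : M} (hb : 0 < b) : ∃ q r, c = q * b + r ∧ r < b := by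
  -- Both quantifiers are bounded in order to allow induction on `c`: increasing `c` increases `r`,
  -- or resets it to `0` with a carry into `q`.
  have : ∃ q, q < c + 1 ∧ ∃ r, r < b ∧ c = q * b + r := by
    refine induction (fun c => ∃ q, q < c + 1 ∧ ∃ r, r < b ∧ c = q * b + r) Bdd.auto
      ⟨0, by simp, 0, hb, by simp⟩ ?_ c
    rintro c ⟨q, hq, r, hr, hc⟩
    rcases (succ_le_iff'.2 hr).lt_or_eq with h | h
    · exact ⟨q, hq.trans (lt_add_one _), r + 1, h, by rw [hc, add_assoc]⟩
    · refine ⟨q + 1, add_lt_add_left hq 1, 0, hb, ?_⟩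
      rw [hc, add_assoc, h]; ring
  obtain ⟨q, -, r, hr, h⟩ := this
  exact ⟨q, r, h, hr⟩

theorem div_unique {b q r q' r' : M} (hr : r < b) (hr' : r' < b)
    (h : q * b + r = q' * b + r') : q = q' ∧ r = r' := by
  have key : ∀ {q r q' r' : M}, r < b → q * b + r = q' * b + r' → ¬ q < q' := by
    intro q r q' r' hr h hq
    have h₁ : (q + 1) * b ≤ q' * b := mul_le_mul_of_nonneg_right (succ_le_iff'.2 hq) zero_le
    have h₂ : q * b + r < (q + 1) * b := by rw [add_mul, one_mul]; exact add_lt_add_right hr _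
    exact absurd (h₂.trans_le (h₁.trans le_self_add)) (by rw [h]; exact lt_irrefl _)
  obtain rfl : q = q' := le_antisymm (not_lt.1 (key hr' h.symm)) (not_lt.1 (key hr h))
  exact ⟨rfl, add_left_cancel h⟩

/-- The digit of `c` at `b ^ x` in base `b` is `i`. -/
def Digit {M : Type} [ExpOps M] (b c x i : M) : Prop :=
  i < b ∧ ∃ u v, c = u * pw b (x + 1) + i * pw b x + v ∧ v < pw b x

/-- `x` belongs to the set coded by `h`. -/
def Mem {M : Type} [ExpOps M] (x h : M) : Prop := Digit (1 + 1) h x 1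

theorem digit_eq (b u x i v : M) :
    u * pw b (x + 1) + i * pw b x + v = (u * b + i) * pw b x + v := by
  rw [pw_succ]; ring

theorem exists_digit {b : M} (hb : 0 < b) (c x : M) : ∃ i, Digit b c x i := by
  obtain ⟨q, v, hc, hv⟩ := exists_div c (pw_pos hb x)
  obtain ⟨u, i, hq, hi⟩ := exists_div q hb
  exact ⟨i, hi, u, v, by rw [digit_eq, hc, hq], hv⟩

theorem Digit.unique {b c x i j : M} (hi : Digit b c x i) (hj : Digit b c x j) : i = j := by
  obtain ⟨hi, u, v, h, hv⟩ := hi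
  obtain ⟨hj, u', v', h', hv'⟩ := hj
  rw [digit_eq] at h h'
  exact (div_unique hi hj (div_unique hv hv' (h.symm.trans h')).1).2

/-- The two unbounded witnesses are summands of `c`, up to a factor at least `1`, so they are at
most `c`. This makes `Digit` a `Σ₀` relation. -/
theorem digit_iff_bounded {b c x i : M} : Digit b c x i ↔ i < b ∧ ∃ u, u < c + 1 ∧ ∃ v, v < c + 1 ∧
    c = u * pw b (x + 1) + i * pw b x + v ∧ v < pw b x := by
  constructor
  · rintro ⟨hi, u, v, h, hv⟩
    refine ⟨hi, u, ?_, v, ?_, h, hv⟩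
    · rw [lt_succ_iff', h, add_assoc]
      exact (le_mul_of_one_le_right zero_le
        (pos_iff_one_le.1 (pw_pos (zero_le.trans_lt hi) _))).trans le_self_add
    · rw [lt_succ_iff', h]
      exact le_add_self
  · rintro ⟨hi, u, -, v, -, h, hv⟩
    exact ⟨hi, u, v, h, hv⟩

theorem bdd_digit {n : ℕ} {b c x i : (Fin n → M) → M} (hb : TF b) (hc : TF c) (hx : TF x)
    (hi : TF i) : Bdd fun v => Digit (b v) (c v) (x v) (i v) := by
  have hb' := hb.lift.lift
  have hc' := hc.lift
  have hc'' := hc'.lift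
  have hx' := hx.lift.lift
  have hi' := hi.lift.lift
  simp only [digit_iff_bounded]
  exact Bdd.auto

theorem bdd_mem {n : ℕ} {x h : (Fin n → M) → M} (hx : TF x) (hh : TF h) :
    Bdd fun v => Mem (x v) (h v) :=
  bdd_digit (.const trivial) hh hx (.const trivial)

theorem bdd_le {n : ℕ} {f g : (Fin n → M) → M} (hf : TF f) (hg : TF g) :
    Bdd fun v => f v ≤ g v :=
  (Sigma0.lt hf hg).or (.equal hf hg)

theorem Mem.pw_le {x h : M} (hx : Mem x h) : pw (1 + 1) x ≤ h := by
  obtain ⟨-, u, v, rfl, -⟩ := hx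
  rw [one_mul]
  exact le_add_self.trans le_self_add

theorem Mem.lt {x h : M} (hx : Mem x h) : x < h := (lt_pw_two x).trans_le hx.pw_le

/-- Bounded choice: every `Σ₀` relation that is total from `{0, …, n - 1}` to `{0, …, B - 1}`
contains a coded function. -/
theorem exists_code {R : M → M → Prop} (hR : Bdd₂ R) {B : M} (n : M)
    (h : ∀ t, t < n → ∃ x, x < B ∧ R t x) :
    ∃ s, s < pw B n ∧ ∀ t, t < n → ∃ x, x < B ∧ Digit B s t x ∧ R t x := by
  -- Exponentiation supplies the bound `B ^ k` on the code, which keeps this existential statement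
  -- `Σ₀`. The step puts a new leading digit in front of `s`.
  have key : ∀ k : M, k ≤ n → ∃ s, s < pw B k ∧ ∀ t, t < k → ∃ x, x < B ∧ Digit B s t x ∧ R t x := by
    refine induction (fun k => k ≤ n → ∃ s, s < pw B k ∧
      ∀ t, t < k → ∃ x, x < B ∧ Digit B s t x ∧ R t x) ?_ ?_ ?_
    · exact .imp (bdd_le (.var _) (.const trivial)) (.bex (.pw (.const trivial) (.var _))
        (.ball (.var _) (.bex (.const trivial)
          (.and (bdd_digit (.const trivial) (.var _) (.var _) (.var _)) (hR (.var _) (.var _))))))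
    · exact fun _ => ⟨0, by simp [pw_zero], fun t ht => (not_below_zero _ ht).elim⟩
    · intro k ih hk
      obtain ⟨s, hs, hd⟩ := ih (le_self_add.trans hk)
      obtain ⟨x, hx, hRx⟩ := h k (succ_le_iff'.1 hk)
      refine ⟨x * pw B k + s, ?_, fun t ht => ?_⟩
      · calc x * pw B k + s < x * pw B k + pw B k := add_lt_add_right hs _
          _ = (x + 1) * pw B k := by ring
          _ ≤ B * pw B k := mul_le_mul_of_nonneg_right (succ_le_iff'.2 hx) zero_le
          _ = pw B (k + 1) := by rw [pw_succ, mul_comm]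
      · rcases (below_succ _ _).1 ht with ht | rfl
        · obtain ⟨y, hy, ⟨-, u, v, e, hv⟩, hRy⟩ := hd t ht
          -- Since `k = t + 1 + w`, the new leading term `x * B ^ k` is a multiple of `B ^ (t + 1)`;
          -- it changes only the part above digit `t`.
          obtain ⟨w, hw⟩ := (le_iff_exists_plus _ _).1 (succ_le_iff'.2 ht)
          refine ⟨y, hy, ⟨hy, x * pw B w + u, v, ?_, hv⟩, hRy⟩
          rw [e, hw, pw_add]; ring
        · exact ⟨x, hx, ⟨hx, 0, s, by ring, hs⟩, hRx⟩
  exact key n le_rfl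

/-- Bounded comprehension. -/
theorem exists_set {P : M → Prop} (hP : Bdd₁ P) (n : M) : ∃ h, ∀ x, Mem x h ↔ x < n ∧ P x := by
  have two : (1 : M) < 1 + 1 := lt_add_one 1
  -- The code is the characteristic function of `P` in base two. The bound `h < 2 ^ n` excludes
  -- members from `n` on.
  obtain ⟨h, hh, hd⟩ := exists_code (R := fun x i => (P x ∧ i = 1) ∨ (¬ P x ∧ i = 0))
    (fun hf hg => .or (.and (hP hf) (.equal hg (.const trivial)))
      (.and (.not (hP hf)) (.equal hg (.const trivial)))) n
    (fun x _ => by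
      by_cases hx : P x
      · exact ⟨1, two, Or.inl ⟨hx, rfl⟩⟩
      · exact ⟨0, zero_lt_one.trans two, Or.inr ⟨hx, rfl⟩⟩)
  refine ⟨h, fun x => ⟨fun hx => ?_, fun ⟨hx, hPx⟩ => ?_⟩⟩
  · have hxn : x < n := by
      by_contra hxn
      exact absurd (hh.trans_le ((pw_mono (zero_lt_one.trans two) (not_lt.1 hxn)).trans hx.pw_le))
        (lt_irrefl _)
    obtain ⟨i, -, hi, ⟨hPx, -⟩ | ⟨-, rfl⟩⟩ := hd x hxn
    · exact ⟨hxn, hPx⟩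
    · exact absurd (Digit.unique hx hi) one_ne_zero
  · obtain ⟨i, -, hi, ⟨-, rfl⟩ | ⟨hn, -⟩⟩ := hd x hx
    · exact hi
    · exact (hn hPx).elim

/-! ### Brown's lemma for linear functions -/

/-- The set coded by `h` has `k` elements. -/
def HasCard {M : Type} [ExpOps M] (h k : M) : Prop :=
  ∃ s, ((∀ j, j < k → ∃ x, Mem x h ∧ Digit (h + 1) s j x) ∧
    (∀ x, Mem x h → ∃ j, j < k ∧ Digit (h + 1) s j x)) ∧
    ∀ i, i < k → ∀ j, j < k → ∀ x, Digit (h + 1) s i x → Digit (h + 1) s j x → i = j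

/-- `x < y` are consecutive elements of the set coded by `h`. -/
def Consecutive {M : Type} [ExpOps M] (h x y : M) : Prop :=
  ((Mem x h ∧ Mem y h) ∧ x < y) ∧ ∀ z, Mem z h → ¬ (x < z ∧ z < y)

/-- The gap size of the set coded by `h` is `d`. -/
def GapSize {M : Type} [ExpOps M] (h d : M) : Prop :=
  ((∃ x y, Consecutive h x y ∧ y = x + d) ∧ ∀ x y, Consecutive h x y → y < x + d + 1) ∨
    ((∀ x y, Mem x h → Mem y h → x = y) ∧ d = 1)

/-- The set coded by `h` has more than `m` times its gap size many elements. -/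
def Large {M : Type} [ExpOps M] (m h : M) : Prop := ∃ k d, (HasCard h k ∧ GapSize h d) ∧ m * d < k

theorem consecutive_iff_bounded {h x y : M} : Consecutive h x y ↔
    ((Mem x h ∧ Mem y h) ∧ x < y) ∧ ∀ z, z < h → Mem z h → ¬ (x < z ∧ z < y) :=
  and_congr_right fun _ => ⟨fun H z _ => H z, fun H z hz => H z hz.lt hz⟩

/-- The gap size is the least upper bound of the differences of consecutive elements. It is positive
because a consecutive pair exists, so its predecessor fails to be a bound, and this shows that it is
attained. -/
theorem exists_gapSize {h x₀ y₀ D : M} (h₀ : Consecutive h x₀ y₀)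
    (hD : ∀ x y, Consecutive h x y → y < x + D + 1) : ∃ d, GapSize h d ∧ d ≤ D := by
  have hb : Bdd₁ fun d : M => ∀ x, x < h → ∀ y, y < h → Consecutive h x y → y < x + d + 1 := by
    intro n f hf
    simp only [consecutive_iff_bounded]
    refine .ball (.const trivial) (.ball (.const trivial) (.imp (.and (.and (.and
      (bdd_mem (.var _) (.const trivial)) (bdd_mem (.var _) (.const trivial)))
      (.lt (.var _) (.var _))) (.ball (.const trivial)
      (.imp (bdd_mem (.var _) (.const trivial)) Bdd.auto))) ?_))
    exact .lt (.var _) (.add (.add (.var _) hf.lift.lift) (.const trivial))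
  obtain ⟨d, hd, hmin⟩ := exists_least
    (P := fun d => ∀ x, x < h → ∀ y, y < h → Consecutive h x y → y < x + d + 1)
    hb (x := D) fun x _ y _ => hD x y
  have hd' : ∀ x y, Consecutive h x y → y < x + d + 1 := fun x y hxy =>
    hd x hxy.1.1.1.lt y hxy.1.1.2.lt hxy
  refine ⟨d, Or.inl ⟨?_, hd'⟩, not_lt.1 fun hlt => hmin D hlt fun x _ y _ => hD x y⟩
  have hpos : 0 < d := by
    rw [pos_iff_ne_zero]
    rintro rfl
    have := hd' _ _ h₀
    rw [add_zero, lt_succ_iff'] at this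
    exact absurd h₀.1.2 (not_lt.2 this)
  obtain ⟨e, rfl⟩ := exists_succ_of_pos hpos
  have := hmin e (lt_add_one e)
  push Not at this
  obtain ⟨x, -, y, -, hxy, hle⟩ := this
  refine ⟨x, y, hxy, le_antisymm (lt_succ_iff'.1 (hd' x y hxy)) ?_⟩
  rwa [← add_assoc]

/-- If a `Σ₀` set meets `K` consecutive blocks of length `b`, where `K > 2 b m`, then it has a
subset with more than `m` times its gap size many elements: the least elements in each block. -/
theorem exists_large {D : M → Prop} (hD : Bdd₁ D) {m b a K : M} (hm : 0 < m) (hb : 0 < b)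
    (hK : K = m * (b + b) + 1) (h : ∀ t, t < K → ∃ x, (a + t * b ≤ x ∧ x < a + (t + 1) * b) ∧ D x) :
    ∃ H, (∀ x, Mem x H → x < a + K * b ∧ D x) ∧ Large m H := by
  let R : M → M → Prop := fun t x =>
    ((a + t * b ≤ x ∧ x < a + (t + 1) * b) ∧ D x) ∧
      ∀ y, y < x → ¬ ((a + t * b ≤ y ∧ y < a + (t + 1) * b) ∧ D y)
  have hR : Bdd₂ R := by
    intro n f g hf hg
    have hf' := hf.lift
    exact .and (.and (.and (bdd_le TF.auto hg) Bdd.auto) (hD hg)) (.ball hg (.not (.and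
      (.and (bdd_le TF.auto (.var _)) Bdd.auto) (hD (.var _)))))
  have ex : ∀ t, t < K → ∃ x, R t x := by
    intro t ht
    obtain ⟨x, hx⟩ := h t ht
    exact exists_least (P := fun x => (a + t * b ≤ x ∧ x < a + (t + 1) * b) ∧ D x)
      (fun hf => .and (.and (bdd_le TF.auto hf) Bdd.auto) (hD hf)) hx
  have uniq : ∀ {t x y}, R t x → R t y → x = y := fun hx hy =>
    le_antisymm (not_lt.1 fun hlt => hx.2 _ hlt hy.1) (not_lt.1 fun hlt => hy.2 _ hlt hx.1)
  have mono : ∀ {t u x y}, R t x → R u y → t < u → x < y := by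
    intro t u x y hx hy htu
    refine hx.1.1.2.trans_le (le_trans ?_ hy.1.1.1)
    exact add_le_add_right (mul_le_mul_of_nonneg_right (succ_le_iff'.2 htu) zero_le) _
  have mono' : ∀ {t u x y}, R t x → R u y → x < y → t < u := by
    intro t u x y hx hy hxy
    rcases lt_trichotomy t u with h | rfl | h
    · exact h
    · exact absurd hxy (uniq hx hy ▸ lt_irrefl _)
    · exact absurd hxy (mono hy hx h).not_gt
  have inj : ∀ {t u x}, R t x → R u x → t = u := by
    intro t u x hx hy
    rcases lt_trichotomy t u with h | h | h
    · exact absurd (mono hx hy h) (lt_irrefl _)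
    · exact h
    · exact absurd (mono hy hx h) (lt_irrefl _)
  obtain ⟨H, hH⟩ := exists_set (P := fun x => ∃ t, t < K ∧ R t x)
    (fun hf => .bex (.const trivial) (hR (.var _) hf.lift)) (a + K * b)
  have mem : ∀ {t x}, t < K → R t x → Mem x H := by
    intro t x ht hx
    refine (hH x).2 ⟨hx.1.1.2.trans_le ?_, t, ht, hx⟩
    exact add_le_add_right (mul_le_mul_of_nonneg_right (succ_le_iff'.2 ht) zero_le) _
  have rep : ∀ {x}, Mem x H → ∃ t, t < K ∧ R t x := fun hx => ((hH _).1 hx).2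
  refine ⟨H, fun x hx => ⟨((hH x).1 hx).1, ?_⟩, ?_⟩
  · obtain ⟨t, -, hx⟩ := rep hx
    exact hx.1.2
  -- The bijection sends `t` to the least point of block `t`. Members of `H` are smaller than `H`,
  -- so base `H + 1` suffices.
  have card : HasCard H K := by
    obtain ⟨s, -, hs⟩ := exists_code hR (B := H + 1) K
      fun t ht => (ex t ht).imp fun x hx => ⟨(mem ht hx).lt.trans (lt_add_one H), hx⟩
    have hs' : ∀ t, t < K → ∀ x, Digit (H + 1) s t x → R t x := by
      intro t ht x hx
      obtain ⟨y, -, hy, hty⟩ := hs t ht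
      rwa [hx.unique hy]
    refine ⟨s, ⟨fun t ht => ?_, fun x hx => ?_⟩, fun i hi j hj x hix hjx =>
      inj (hs' i hi x hix) (hs' j hj x hjx)⟩
    · obtain ⟨x, -, hx, htx⟩ := hs t ht
      exact ⟨x, mem ht htx, hx⟩
    · obtain ⟨t, ht, htx⟩ := rep hx
      obtain ⟨y, -, hy, hty⟩ := hs t ht
      exact ⟨t, ht, uniq hty htx ▸ hy⟩
  have gap : ∀ x y, Consecutive H x y → y < x + (b + b) + 1 := by
    rintro x y ⟨⟨⟨hx, hy⟩, hxy⟩, hz⟩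
    obtain ⟨t, ht, hx⟩ := rep hx
    obtain ⟨u, hu, hy⟩ := rep hy
    have htu := mono' hx hy hxy
    -- Otherwise the point chosen in block `t + 1` would lie strictly between `x` and `y`. Two
    -- points in adjacent blocks differ by at most `2 b`.
    have hle : u ≤ t + 1 := by
      by_contra hlt
      rw [not_le] at hlt
      obtain ⟨z, hz'⟩ := ex (t + 1) (hlt.trans hu)
      exact hz z (mem (hlt.trans hu) hz') ⟨mono hx hz' (lt_add_one t), mono hz' hy hlt⟩
    have h₁ := hx.1.1.1
    have h₂ := hy.1.1.2
    have h₃ : (u + 1) * b ≤ (t + 1 + 1) * b :=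
      mul_le_mul_of_nonneg_right (add_le_add_left hle 1) zero_le
    rw [lt_succ_iff']
    refine h₂.le.trans ((add_le_add_right h₃ a).trans ?_)
    rw [show a + (t + 1 + 1) * b = a + t * b + (b + b) by ring]
    exact add_le_add_left h₁ _
  -- There are at least two blocks. The points chosen in blocks `0` and `1` are a consecutive pair,
  -- so the gap size is a genuine difference.
  have h1K : 1 < K := by
    rw [hK]
    exact lt_add_of_pos_left _ (mul_pos hm (add_pos hb hb))
  obtain ⟨x, hx⟩ := ex 0 (zero_lt_one.trans h1K)
  obtain ⟨y, hy⟩ := ex 1 h1K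
  obtain ⟨d, hd, hdle⟩ := exists_gapSize (h := H) (x₀ := x) (y₀ := y)
    ⟨⟨⟨mem (zero_lt_one.trans h1K) hx, mem h1K hy⟩, mono hx hy zero_lt_one⟩, fun z hz hxzy => by
      obtain ⟨t, -, hz⟩ := rep hz
      have h₁ := mono' hx hz hxzy.1
      have h₂ := mono' hz hy hxzy.2
      exact absurd (pos_iff_one_le.1 h₁) (not_le.2 h₂)⟩ gap
  refine ⟨K, d, ⟨card, hd⟩, ?_⟩
  rw [hK, lt_succ_iff']
  exact mul_le_mul_of_nonneg_left hdle zero_le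

/-- The set coded by `h` is homogeneous for the coloring of `{0, …, N - 1}` coded by `c`. -/
def Homogeneous {M : Type} [ExpOps M] (r N c h : M) : Prop := ∃ i, ∀ x, Mem x h → x < N ∧ Digit r c x i

/-- Finite Brown's lemma for the functions `d ↦ m d`. -/
theorem brown_linear {m r : M} (hm : 0 < m) (hr : 0 < r) :
    ∃ N, ∀ c, c < pw r N → ∃ h, Homogeneous r N c h ∧ Large m h := by
  -- The exponent `3 ^ j` makes each step cube the length. The base `3m` gives `2m F(j) + 1 ≤ 3m
  -- F(j) ≤ F(j) ^ 2`, so that the `2m F(j) + 1` blocks of length `F j` fit into `F (j + 1)`.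
  let F : M → M := fun j => pw (m + m + m) (pw (1 + 1 + 1) j)
  have h3m : 0 < m + m + m := add_pos (add_pos hm hm) hm
  have h3 : (0 : M) < 1 + 1 + 1 := add_pos (add_pos one_pos one_pos) one_pos
  have hF : ∀ j, 0 < F j := fun j => pw_pos h3m _
  have hFm : ∀ j, m + m + m ≤ F j := fun j => by
    have := pw_mono h3m (pos_iff_one_le.1 (pw_pos h3 j))
    rwa [← zero_add 1, pw_succ, pw_zero, one_mul, zero_add] at this
  have hFs : ∀ j, F (j + 1) = F j * F j * F j := fun j => by
    simp only [F]
    rw [pw_succ, mul_add, mul_add, mul_one, pw_add, pw_add]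
  have hstep : ∀ j, (m * (F j + F j) + 1) * F j ≤ F (j + 1) := fun j => by
    have h₁ : 1 ≤ m * F j := pos_iff_one_le.1 (mul_pos hm (hF j))
    calc (m * (F j + F j) + 1) * F j ≤ (m * (F j + F j) + m * F j) * F j :=
          mul_le_mul_of_nonneg_right (add_le_add_right h₁ _) zero_le
      _ = (m + m + m) * F j * F j := by ring
      _ ≤ F j * F j * F j := mul_le_mul_of_nonneg_right
          (mul_le_mul_of_nonneg_right (hFm j) zero_le) zero_le
      _ = F (j + 1) := (hFs j).symm
  refine ⟨F r, fun c _ => ?_⟩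
  -- The absence of large homogeneous sets is not a `Σ₀` statement as written; it is assumed outside
  -- the induction and kept out of its invariant.
  by_contra hno
  -- The equation `j + k = r` replaces the subtraction `r - k`. The bounds on `j`, `a` and `x` serve
  -- only to make the invariant `Σ₀`.
  have key : ∀ k : M, ∀ j, j < r + 1 → j + k = r → ∃ a, a < F r + 1 ∧ a + F j ≤ F r ∧
      ∀ x, x < F r → a ≤ x → x < a + F j → ∀ i, i < k → ¬ Digit r c x i := by
    refine induction (fun k => ∀ j, j < r + 1 → j + k = r → ∃ a, a < F r + 1 ∧ a + F j ≤ F r ∧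
      ∀ x, x < F r → a ≤ x → x < a + F j → ∀ i, i < k → ¬ Digit r c x i) ?_ ?_ ?_
    · have hFT : ∀ {n : ℕ} {f : (Fin n → M) → M}, TF f → TF fun v => F (f v) := fun hf =>
        .pw (.const trivial) (.pw (.const trivial) hf)
      exact .ball (.const trivial) (.imp Bdd.auto (.bex (.const trivial) (.and
        (bdd_le (.add (.var _) (hFT (.var _))) (.const trivial)) (.ball (.const trivial)
        (.imp (bdd_le (.var _) (.var _)) (.imp (.lt (.var _) (.add (.var _) (hFT (.var _))))
        (.ball (.var _) (.not (bdd_digit (.const trivial) (.const trivial)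
          (.var _) (.var _))))))))))
    · rintro j - hj
      rw [add_zero] at hj
      subst hj
      exact ⟨0, zero_le.trans_lt (lt_add_one _), by rw [zero_add],
        fun _ _ _ _ i hi => (not_below_zero _ hi).elim⟩
    · intro k ih j _ hjk
      have hjk' : j + 1 + k = r := by rw [← hjk]; ring
      obtain ⟨a, -, ha, hfree⟩ := ih (j + 1) (lt_succ_iff'.2 (hjk' ▸ le_self_add)) hjk'
      have hblock : ∃ t, t < m * (F j + F j) + 1 ∧
          ∀ x, a + t * F j ≤ x → x < a + (t + 1) * F j → ¬ Digit r c x k := by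
        by_contra hall
        push Not at hall
        obtain ⟨H, hH, hlarge⟩ := exists_large (D := fun x => Digit r c x k)
          (fun hf => bdd_digit (.const trivial) (.const trivial) hf (.const trivial))
          (a := a) hm (hF j) rfl fun t ht => by
            obtain ⟨x, h₁, h₂, h₃⟩ := hall t ht
            exact ⟨x, ⟨h₁, h₂⟩, h₃⟩
        -- If color `k` occurs in every block, the set of its least occurrences contradicts `hno`.
        exact hno ⟨H, ⟨k, fun x hx => ⟨(hH x hx).1.trans_le
          ((add_le_add_right (hstep j) a).trans ha), (hH x hx).2⟩⟩, hlarge⟩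
      obtain ⟨t, ht, hfree'⟩ := hblock
      have h₁ : a + t * F j + F j ≤ a + F (j + 1) := by
        refine le_trans ?_ (add_le_add_right (hstep j) a)
        rw [show a + t * F j + F j = a + (t + 1) * F j by ring]
        exact add_le_add_right (mul_le_mul_of_nonneg_right (succ_le_iff'.2 ht) zero_le) _
      refine ⟨a + t * F j, lt_succ_iff'.2 (le_self_add.trans (h₁.trans ha)), h₁.trans ha,
        fun x hx hax hxa i hi => ?_⟩
      rcases (below_succ _ _).1 hi with hi | rfl
      · exact hfree x hx (le_self_add.trans hax) (hxa.trans_le h₁) i hi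
      · exact hfree' x hax (by rwa [show a + (t + 1) * F j = a + t * F j + F j by ring])
  -- The interval of length `F 0 > 0` avoids all `r` colors, yet its first point `a` has a color,
  -- namely a digit below `r`.
  obtain ⟨a, -, ha, hfree⟩ := key r 0 (zero_le.trans_lt (lt_add_one _)) (zero_add r)
  have ha' : a < a + F 0 := lt_add_of_pos_right _ (hF 0)
  obtain ⟨i, hi⟩ := exists_digit hr c a
  exact hfree a (ha'.trans_le ha) le_rfl ha' i hi.1 hi

end EFAModel

end BrownEFA

namespace BrownEFA

open FirstOrder FirstOrder.Language
open ExpOps (pw)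

/-! ### Models of the theory `EFA` -/

section Realization

variable {M : Type} [LExp.Structure M]

/-- The operations of a structure for the language of arithmetic with exponentiation. -/
@[reducible]
def expOps (M : Type) [LExp.Structure M] : ExpOps M where
  zero := Structure.funMap (L := LExp) ArithFunc.zero ![]
  one := Structure.funMap (L := LExp) ArithFunc.one ![]
  add x y := Structure.funMap (L := LExp) ArithFunc.add ![x, y]
  mul x y := Structure.funMap (L := LExp) ArithFunc.mul ![x, y]
  pw x y := Structure.funMap (L := LExp) ArithFunc.exp ![x, y]
  lt x y := Structure.RelMap (L := LExp) ArithRel.lt ![x, y]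

attribute [local instance] expOps

variable {n : ℕ} {e : Empty → M} (v : Fin n → M)

@[simp]
theorem val_zero : Term.realize (Sum.elim e v) (0 : Tm n) = 0 := Term.realize_constants.trans
  (congrArg (Structure.funMap (L := LExp) ArithFunc.zero) (Subsingleton.elim _ _))

@[simp]
theorem val_one : Term.realize (Sum.elim e v) (1 : Tm n) = 1 := Term.realize_constants.trans
  (congrArg (Structure.funMap (L := LExp) ArithFunc.one) (Subsingleton.elim _ _))

@[simp]
theorem val_add (s t : Tm n) : Term.realize (Sum.elim e v) (s + t) = Term.realize (Sum.elim e v) s + Term.realize (Sum.elim e v) t :=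
  Term.realize_functions_apply₂

@[simp]
theorem val_mul (s t : Tm n) : Term.realize (Sum.elim e v) (s * t) = Term.realize (Sum.elim e v) s * Term.realize (Sum.elim e v) t :=
  Term.realize_functions_apply₂

@[simp]
theorem val_pow (s t : Tm n) : Term.realize (Sum.elim e v) (s ^ t) = pw (Term.realize (Sum.elim e v) s) (Term.realize (Sum.elim e v) t) :=
  Term.realize_functions_apply₂

@[simp]
theorem val_var (i : Fin n) : Term.realize (Sum.elim e v) (var i) = v i := rfl

@[simp]
theorem val_new (a : M) : Term.realize (Sum.elim e (Fin.snoc v a : Fin (n + 1) → M)) new = a := by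
  simp [new]

@[simp]
theorem val_up (a : M) (t : Tm n) : 
    Term.realize (Sum.elim e (Fin.snoc v a : Fin (n + 1) → M)) (up t) = Term.realize (Sum.elim e v) t := by
  unfold up
  rw [Term.realize_relabel]
  congr 1
  funext i
  rcases i with i | i
  · rfl
  · simp

@[simp]
theorem realize_lt (s t : Tm n) : (lt s t).Realize e v ↔ Term.realize (Sum.elim e v) s < Term.realize (Sum.elim e v) t :=
  BoundedFormula.realize_rel₂

@[simp]
theorem realize_ball (t : Tm n) (φ : Fm (n + 1)) : (ball t φ).Realize e v ↔
    ∀ x, x < Term.realize (Sum.elim e v) t → φ.Realize e (Fin.snoc v x) := by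
  simp [ball]

@[simp]
theorem realize_bex (t : Tm n) (φ : Fm (n + 1)) : (bex t φ).Realize e v ↔
    ∃ x, x < Term.realize (Sum.elim e v) t ∧ φ.Realize e (Fin.snoc v x) := by
  simp [bex]

theorem realize_substVars {m : ℕ} (φ : Fm m) (ts : Fin m → Tm n) :
    (substVars φ ts).Realize e v ↔ φ.Realize e fun i => Term.realize (Sum.elim e v) (ts i) := by
  unfold substVars
  rw [BoundedFormula.realize_relabel, BoundedFormula.realize_subst,
    Subsingleton.elim (v ∘ Fin.natAdd n : Fin 0 → M) default]
  refine (BoundedFormula.realize_toFormula φ _).trans (iff_of_eq ?_)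
  congr 1
  exact Subsingleton.elim _ _

theorem exists_term {p : ℕ} (w : Fin p → M) {f : (Fin n → M) → M} (hf : TermFun (Set.range w) f) :
    ∃ t : Tm (p + n), ∀ v, Term.realize (Sum.elim e (Fin.append w v)) t = f v := by
  induction hf with
  | var i => exact ⟨var (i.natAdd p), fun v => by simp⟩
  | const h =>
    obtain ⟨i, rfl⟩ := h
    exact ⟨var (i.castAdd n), fun v => by simp⟩
  | zero => exact ⟨0, fun v => by simp⟩
  | one => exact ⟨1, fun v => by simp⟩
  | add _ _ h₁ h₂ =>
    obtain ⟨s, hs⟩ := h₁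
    obtain ⟨t, ht⟩ := h₂
    exact ⟨s + t, fun v => by simp [hs, ht]⟩
  | mul _ _ h₁ h₂ =>
    obtain ⟨s, hs⟩ := h₁
    obtain ⟨t, ht⟩ := h₂
    exact ⟨s * t, fun v => by simp [hs, ht]⟩
  | pw _ _ h₁ h₂ =>
    obtain ⟨s, hs⟩ := h₁
    obtain ⟨t, ht⟩ := h₂
    exact ⟨s ^ t, fun v => by simp [hs, ht]⟩

theorem snoc_append {α : Type} {p n : ℕ} (w : Fin p → α) (v : Fin n → α) (x : α) :
    (Fin.snoc (Fin.append w v) x : Fin (p + n + 1) → α) =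
      Fin.append w (Fin.snoc v x : Fin (n + 1) → α) :=
  (Fin.append_snoc w v x).symm

/-- The way back from semantic definability to syntax: the parameters `w` become the first `p`
variables of the formula. -/
theorem exists_formula {p : ℕ} (w : Fin p → M) {P : (Fin n → M) → Prop}
    (hP : Sigma0 (Set.range w) P) :
    ∃ φ : Fm (p + n), IsSigma0 φ ∧ ∀ v, φ.Realize e (Fin.append w v) ↔ P v := by
  induction hP with
  | falsum => exact ⟨⊥, .falsum, fun v => Iff.rfl⟩
  | equal hf hg =>
    obtain ⟨s, hs⟩ := exists_term (e := e) w hf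
    obtain ⟨t, ht⟩ := exists_term (e := e) w hg
    exact ⟨s =' t, .equal s t, fun v => by simp [hs, ht]⟩
  | lt hf hg =>
    obtain ⟨s, hs⟩ := exists_term (e := e) w hf
    obtain ⟨t, ht⟩ := exists_term (e := e) w hg
    exact ⟨lt s t, .lt s t, fun v => by simp [hs, ht]⟩
  | imp _ _ h₁ h₂ =>
    obtain ⟨φ, hφ, h₁⟩ := h₁
    obtain ⟨ψ, hψ, h₂⟩ := h₂
    exact ⟨φ ⟹ ψ, .imp hφ hψ, fun v => by simp [h₁, h₂]⟩
  | ball hf _ hQ =>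
    obtain ⟨t, ht⟩ := exists_term (e := e) w hf
    obtain ⟨φ, hφ, h⟩ := hQ
    exact ⟨ball t φ, .ball t hφ, fun v => by
      simp only [realize_ball, ht, snoc_append]
      refine forall_congr' fun x => imp_congr_right fun _ => (h _).trans ?_
      simp⟩
  | bex hf _ hQ =>
    obtain ⟨t, ht⟩ := exists_term (e := e) w hf
    obtain ⟨φ, hφ, h⟩ := hQ
    exact ⟨bex t φ, .bex t hφ, fun v => by
      simp only [realize_bex, ht, snoc_append]
      refine exists_congr fun x => and_congr_right fun _ => (h _).trans ?_
      simp⟩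

theorem induction_of_models (hM : M ⊨ EFA) (P : M → Prop) (hP : Bdd fun v : Fin 1 → M => P (v 0))
    (h₀ : P 0) (h₁ : ∀ x, P x → P (x + 1)) (x : M) : P x := by
  obtain ⟨B, hB, hP⟩ := hP.exists_finite
  -- The finite parameter set is listed as the range of a tuple `w`, at which the universally closed
  -- induction axiom is then instantiated.
  obtain ⟨p, w, -, rfl⟩ := hB.fin_param
  obtain ⟨φ, hφ, h⟩ := exists_formula (e := default) w hP
  have hax : M ⊨ inductionAxiom φ := hM.realize_of_mem _ (Or.inr ⟨_, φ, hφ, rfl⟩)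
  have hφP : ∀ x, φ.Realize default (Fin.snoc w x : Fin (p + 1) → M) ↔ P x := fun x => by
    have := h (fun _ => x)
    rwa [Fin.append_right_eq_snoc] at this
  have := BoundedFormula.realize_alls.1 hax w
  simp only [BoundedFormula.realize_imp, BoundedFormula.realize_all, realize_substVars] at this
  have snoc : ∀ {k : ℕ} (u : Fin k → M) (f : Fin p → Tm k) (t : Tm k),
      (∀ i, Term.realize (Sum.elim default u) (f i) = w i) →
      (fun i => Term.realize (Sum.elim default u) ((Fin.snoc f t : Fin (p + 1) → Tm k) i)) =
        (Fin.snoc w (Term.realize (Sum.elim default u) t) : Fin (p + 1) → M) := by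
    intro k u f t hf
    funext i
    refine Fin.lastCases ?_ (fun i => ?_) i <;> simp [hf]
  refine (hφP x).1 (this ?_ (fun y hy => ?_) x)
  · rw [snoc _ _ _ (by simp), val_zero]
    exact (hφP 0).2 h₀
  · rw [snoc _ _ _ (by simp), val_add, val_new, val_one]
    exact (hφP _).2 (h₁ y ((hφP y).1 hy))

/-- Every basic axiom is closed over two variables, including those in which only `x` occurs; for
the latter a dummy value `0` is supplied for `y`. -/
theorem basic_of_models (hM : M ⊨ EFA) {φ : Fm 2} (hφ : φ.alls ∈ basicAxioms) (x y : M) :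
    ∃ v : Fin 2 → M, v 0 = x ∧ v 1 = y ∧ φ.Realize default v :=
  ⟨![x, y], rfl, rfl, BoundedFormula.realize_alls.1 (hM.realize_of_mem _ (Or.inl hφ)) _⟩

/-- A model of the theory `EFA` as a model in the algebraic sense. -/
@[reducible]
def efaModel (hM : M ⊨ EFA) : EFAModel M where
  __ := expOps M
  succ_ne_zero x := by
    obtain ⟨v, rfl, -, h⟩ := basic_of_models hM (φ := ∼((var 0 + 1) =' 0)) (by simp [basicAxioms]) x 0
    simpa using h
  succ_inj x y := by
    obtain ⟨v, rfl, rfl, h⟩ := basic_of_models hM (φ := (var 0 + 1) =' (var 1 + 1) ⟹ var 0 =' var 1)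
      (by simp [basicAxioms]) x y
    simpa using h
  plus_zero x := by
    obtain ⟨v, rfl, -, h⟩ := basic_of_models hM (φ := (var 0 + 0) =' var 0) (by simp [basicAxioms]) x 0
    simpa using h
  plus_succ x y := by
    obtain ⟨v, rfl, rfl, h⟩ := basic_of_models hM (φ := (var 0 + (var 1 + 1)) =' ((var 0 + var 1) + 1))
      (by simp [basicAxioms]) x y
    simpa using h
  times_zero x := by
    obtain ⟨v, rfl, -, h⟩ := basic_of_models hM (φ := (var 0 * 0) =' 0) (by simp [basicAxioms]) x 0
    simpa using h
  times_succ x y := by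
    obtain ⟨v, rfl, rfl, h⟩ := basic_of_models hM (φ := (var 0 * (var 1 + 1)) =' (var 0 * var 1 + var 0))
      (by simp [basicAxioms]) x y
    simpa using h
  pw_zero x := by
    obtain ⟨v, rfl, -, h⟩ := basic_of_models hM (φ := (var 0 ^ (0 : Tm 2)) =' 1) (by simp [basicAxioms]) x 0
    simpa using h
  pw_succ x y := by
    obtain ⟨v, rfl, rfl, h⟩ := basic_of_models hM (φ := ((var 0 : Tm 2) ^ (var 1 + 1 : Tm 2)) =' ((var 0 : Tm 2) ^ (var 1 : Tm 2) * var 0))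
      (by simp [basicAxioms]) x y
    simpa using h
  not_below_zero x := by
    obtain ⟨v, rfl, -, h⟩ := basic_of_models hM (φ := ∼(lt (var 0) 0)) (by simp [basicAxioms]) x 0
    simpa using h
  below_succ x y := by
    obtain ⟨v, rfl, rfl, h⟩ := basic_of_models hM
      (φ := lt (var 0) (var 1 + 1) ⇔ (lt (var 0) (var 1) ⊔ var 0 =' var 1))
      (by simp [basicAxioms]) x y
    simpa using h
  induction := induction_of_models hM

/-! ### The combinatorial notions in a structure -/

open EFAModel

-- `Digit` and the other semantic notions mirror the formulas down to the bracketing of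
-- conjunctions, so unfolding both sides and evaluating terms is enough.
@[simp]
theorem realize_digit (b c x i : Tm n) : (digit b c x i).Realize e v ↔
    Digit (Term.realize (Sum.elim e v) b) (Term.realize (Sum.elim e v) c)
      (Term.realize (Sum.elim e v) x) (Term.realize (Sum.elim e v) i) := by
  simp [digit, Digit]

@[simp]
theorem realize_mem (x h : Tm n) : (mem x h).Realize e v ↔
    Mem (Term.realize (Sum.elim e v) x) (Term.realize (Sum.elim e v) h) := by
  simp [mem, Mem]

@[simp]
theorem realize_hasCard (h k : Tm n) : (hasCard h k).Realize e v ↔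
    HasCard (Term.realize (Sum.elim e v) h) (Term.realize (Sum.elim e v) k) := by
  simp [hasCard, HasCard]

@[simp]
theorem realize_consecutive (h x y : Tm n) : (consecutive h x y).Realize e v ↔
    Consecutive (Term.realize (Sum.elim e v) h) (Term.realize (Sum.elim e v) x)
      (Term.realize (Sum.elim e v) y) := by
  simp [consecutive, Consecutive]

@[simp]
theorem realize_gapSize (h d : Tm n) : (gapSize h d).Realize e v ↔
    GapSize (Term.realize (Sum.elim e v) h) (Term.realize (Sum.elim e v) d) := by
  simp [gapSize, GapSize]

@[simp]
theorem realize_homogeneous (r N c h : Tm n) : (homogeneous r N c h).Realize e v ↔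
    Homogeneous (Term.realize (Sum.elim e v) r) (Term.realize (Sum.elim e v) N)
      (Term.realize (Sum.elim e v) c) (Term.realize (Sum.elim e v) h) := by
  simp [homogeneous, Homogeneous]

/-- In the term `var 0 * var 1` the first variable is the parameter `m` and the second is replaced
by the gap size. The content is the evaluation of this substitution under the two quantifiers of
`large`. -/
theorem realize_large_linear {q : ℕ} (v : Fin (1 + q) → M) (h : Tm (1 + q)) :
    (large (p := 1) (q := q) (var 0 * var 1) h).Realize e v ↔
      Large (v (Fin.castAdd q 0)) (Term.realize (Sum.elim e v) h) := by
  have hf : ∀ k d : M, Term.realize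
      (Sum.elim e (Fin.snoc (Fin.snoc v k : Fin (1 + q + 1) → M) d : Fin (1 + q + 2) → M))
      (Term.subst (var 0 * var 1 : Tm (1 + 1)) (Sum.elim Empty.elim
        (Fin.snoc (fun i : Fin 1 => var (((i.castAdd q).castSucc).castSucc)) new))) =
      v (Fin.castAdd q 0) * d := by
    intro k d
    rw [Term.realize_subst]
    refine Eq.trans (congrArg (Term.realize · _) (funext ?_ : _ = Sum.elim e
      ![v (Fin.castAdd q 0), d])) (by rw [val_mul]; rfl)
    rintro (a | i)
    · exact a.elim
    · refine Fin.lastCases ?_ (fun j => ?_) i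
      · rw [Sum.elim_inr, Sum.elim_inr, Fin.snoc_last, val_new]
        rfl
      · obtain rfl := Subsingleton.elim j 0
        simp
  simp [large, Large, hf]

theorem realize_linearBL : M ⊨ linearBL ↔ ∀ m : M, 0 < m → ∀ r : M, 0 < r →
    ∃ N, ∀ c, c < pw r N → ∃ h, Homogeneous r N c h ∧ Large m h := by
  have snoc_zero : ∀ a : M, (Fin.snoc default a : Fin 1 → M) 0 = a := fun _ => rfl
  simp [Sentence.Realize, Formula.Realize, linearBL, BL, realize_large_linear, snoc_zero]

end Realization

/-- Countability of the language is needed for the enumeration of formulas in the Henkin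
construction. -/
instance : Countable LExp.Symbols := by
  have hf : Countable (Σ n, LExp.Functions n) := by
    refine Function.Surjective.countable (f := fun i : Fin 5 =>
      (![⟨0, ArithFunc.zero⟩, ⟨0, ArithFunc.one⟩, ⟨2, ArithFunc.add⟩, ⟨2, ArithFunc.mul⟩,
        ⟨2, ArithFunc.exp⟩] i : Σ n, ArithFunc n)) ?_
    rintro ⟨_, _ | _ | _ | _ | _⟩
    exacts [⟨0, rfl⟩, ⟨1, rfl⟩, ⟨2, rfl⟩, ⟨3, rfl⟩, ⟨4, rfl⟩]
  have hr : Countable (Σ n, LExp.Relations n) := by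
    refine Function.Surjective.countable
      (f := fun _ : Unit => (⟨2, ArithRel.lt⟩ : Σ n, ArithRel n)) ?_
    rintro ⟨_, ⟨⟩⟩
    exact ⟨(), rfl⟩
  exact instCountableSum

end BrownEFA

theorem mainTheorem6 : BrownEFA.Provable BrownEFA.EFA BrownEFA.linearBL := by
  refine BrownEFA.provable_of_models fun M _ hM => BrownEFA.realize_linearBL.2 fun m hm r hr => ?_
  let _ := BrownEFA.efaModel hM
  exact BrownEFA.EFAModel.brown_linear hm hr
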